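/- Let $M$ be a smooth $m$-dimensional manifold and $\pi\colon LM\to M$ its bundle of linear frames; a frame $u\in LM$ over $x$ is a linear isomorphism $u\colon\mathbb R^m\to T_xM$, and $a\in\mathrm{GL}(m,\mathbb R)$ acts by $u\cdot a=u\circ a$. Let $\mathsf K$ be an element of the (mixed) tensor algebra over $\mathbb R^m$, and let $G\subseteq \mathrm{GL}(m,\mathbb R)$ be the group of linear transformations that leave $\mathsf K$ invariant. Assume that $G$ is reductive in $\mathrm{GL}(m,\mathbb R)$, i.e. $\mathfrak{gl}(m,\mathbb R)=\mathfrak g\oplus\mathfrak m$, where $\mathfrak g$ is the Lie algebra of $G$ and $\mathfrak m$ is an $\mathrm{Ad}_G$-invariant subspace, and fix such an $\mathfrak m$. Let $P$ be a $G$-structure on $M$, i.e. a principal $G$-subbundle of $LM$, and let $K$ be the tensor field on $M$ defined by $\mathsf K$ and $P$: $K_x$ is the image of $\mathsf K$ under the isomorphism of tensor algebras induced by any $u\in P$ over $x$. An automorphism $\Phi$ of $LM$ is a diffeomorphism of $LM$ that commutes with the action of $\mathrm{GL}(m,\mathbb R)$; it induces a diffeomorphism $\varphi$ of $M$ and, for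 $u\in LM$ over $x$, the linear isomorphism $\Phi(u)\circ u^{-1}\colon T_xM\to T_{\varphi(x)}M$, which depends only on $x$, and hence a map $\Phi_\lambda$ of tensors. $\Phi$ leaves $K$ invariant if $\Phi_\lambda(K_x)=K_{\varphi(x)}$ for all $x\in M$. $\Phi$ is a generalized automorphism of $P$ if $\Phi(P)\subseteq P$. Let $\Xi$ be a smooth $\mathrm{GL}(m,\mathbb R)$-invariant vector field on $LM$ with local flow $\Phi_t$, and let $\xi$ be the vector field on $M$ on which $\Xi$ projects, with local flow $\varphi_t$. $\Xi$ is an infinitesimal generalized automorphism of $P$ if $\Phi_t$ maps $P$ into $P$ (wherever it is defined) for every $t$. The Lie derivative of $K$ is $$(\pounds_\Xi K)_x=\frac{d}{dt}\Big|_{t=0}(\Phi_{-t})_\lambda\big(K_{\varphi_t(x)}\big).$$ The generalized Kosmann vector field $\Xi_{\mathrm K}$ on $P$ is the component of $\Xi|_P$ in $TP$ with respect to the decomposition $T_uLM=T_uP\oplus\mathcal M_u$, $u\in P$, where $\mathcal M_u$ consists of the values at $u$ of the fundamental vector fields of the elements of $\mathfrak m$. The $G$-reductive Lie derivative $\pounds^G_\Xi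 K$ is defined by the same formula as $\pounds_\Xi K$, with the flow of $\Xi_{\mathrm K}$ on $P$ in place of $\Phi_t$ (the induced maps of tensors being computed with frames $u\in P$) and the same $\varphi_t$. Then: (1) an automorphism $\Phi\colon LM\to LM$ is a generalized automorphism of $P$ if and only if $\Phi$ leaves $K$ invariant; (2) a $\mathrm{GL}(m,\mathbb R)$-invariant vector field $\Xi$ on $LM$ is an infinitesimal generalized automorphism of $P$ if and only if $\pounds_\Xi K=0$; (3) $\pounds^G_\Xi K\equiv 0$ for every $\mathrm{GL}(m,\mathbb R)$-invariant vector field $\Xi$ on $LM$. -/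

import Mathlib

open scoped Manifold ContDiff Topology DirectSum
open Set Filter

noncomputable section

namespace GStr

/-! ### Mixed tensors -/

/-- Tensors of type `(r, s)` over a real vector space `V`, as multilinear functions of `r` covectors
and `s` vectors. -/
abbrev MixedTensor (V : Type*) [AddCommGroup V] [Module ℝ V] (r s : ℕ) : Type _ :=
  MultilinearMap ℝ (fun _ : Fin r => Module.Dual ℝ V) (MultilinearMap ℝ (fun _ : Fin s => V) ℝ)

/-- The underlying space of the (mixed) tensor algebra over `V`: the direct sum of the spaces of
tensors of all types `(r, s)`. -/
abbrev Tensors (V : Type*) [AddCommGroup V] [Module ℝ V] : Type _ :=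
  ⨁ rs : ℕ × ℕ, MixedTensor V rs.1 rs.2

section Push

variable {V W X : Type*} [AddCommGroup V] [Module ℝ V] [AddCommGroup W] [Module ℝ W]
  [AddCommGroup X] [Module ℝ X]

/-- The map of tensors of type `(r, s)` induced by a linear isomorphism `e : V ≃ W`:
`(e_* T)(α₁, …, αᵣ, w₁, …, wₛ) = T(α₁ ∘ e, …, αᵣ ∘ e, e⁻¹ w₁, …, e⁻¹ wₛ)`. -/
def pushMixed (e : V ≃ₗ[ℝ] W) (r s : ℕ) : MixedTensor V r s →ₗ[ℝ] MixedTensor W r s where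
  toFun T := (MultilinearMap.compLinearMapₗ (fun _ : Fin s => e.symm.toLinearMap)).compMultilinearMap
    (T.compLinearMap (fun _ => e.toLinearMap.dualMap))
  map_add' _ _ := rfl
  map_smul' _ _ := rfl

theorem pushMixed_apply (e : V ≃ₗ[ℝ] W) (r s : ℕ) (T : MixedTensor V r s)
    (α : Fin r → Module.Dual ℝ W) (w : Fin s → W) :
    pushMixed e r s T α w = T (fun i => (α i).comp e.toLinearMap) (fun j => e.symm (w j)) := rfl

/-- The map of the tensor algebras induced by a linear isomorphism. -/
def push (e : V ≃ₗ[ℝ] W) : Tensors V →ₗ[ℝ] Tensors W :=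
  DirectSum.lmap (fun rs : ℕ × ℕ => pushMixed e rs.1 rs.2)

theorem push_apply (e : V ≃ₗ[ℝ] W) (T : Tensors V) (rs : ℕ × ℕ) :
    push e T rs = pushMixed e rs.1 rs.2 (T rs) := rfl

theorem push_refl (T : Tensors V) : push (LinearEquiv.refl ℝ V) T = T := by
  refine DFinsupp.ext fun rs => ?_
  rfl

theorem push_trans (e : V ≃ₗ[ℝ] W) (f : W ≃ₗ[ℝ] X) (T : Tensors V) :
    push (e.trans f) T = push f (push e T) := by
  refine DFinsupp.ext fun rs => ?_
  rfl

/-- `f : ℝ → Tensors V` has derivative `L` at `t₀`; this is expressed through the values of the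
tensors on all covectors and vectors (that is, through their components). -/
def HasTensorDerivAt (f : ℝ → Tensors V) (L : Tensors V) (t₀ : ℝ) : Prop :=
  ∀ (rs : ℕ × ℕ) (α : Fin rs.1 → Module.Dual ℝ V) (v : Fin rs.2 → V),
    HasDerivAt (fun t => f t rs α v) (L rs α v) t₀

end Push

/-! ### The general linear group and its subgroups -/

/-- The vector space `ℝᵐ`. -/
abbrev Eu (m : ℕ) : Type := EuclideanSpace ℝ (Fin m)

/-- The Lie group `GL(m, ℝ)`, with Mathlib's smooth structure on the units of `End(ℝᵐ)`. -/
abbrev GLm (m : ℕ) : Type := (Eu m →L[ℝ] Eu m)ˣ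

/-- An element of `GL(m, ℝ)` as a linear isomorphism. -/
def GLm.toEquiv {m : ℕ} (a : GLm m) : Eu m ≃ₗ[ℝ] Eu m :=
  (ContinuousLinearEquiv.unitsEquiv ℝ (Eu m) a).toLinearEquiv

/-- The group of the linear transformations of `ℝᵐ` that leave the tensor `T` invariant. -/
def stabilizer {m : ℕ} (T : Tensors (Eu m)) : Subgroup (GLm m) where
  carrier := {a | push a.toEquiv T = T}
  one_mem' := push_refl T
  mul_mem' {a b} ha hb := by
    have h : (a * b).toEquiv = b.toEquiv.trans a.toEquiv := rfl
    simp only [mem_ofPred_eq] at ha hb ⊢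
    rw [h, push_trans, hb, ha]
  inv_mem' {a} ha := by
    simp only [mem_ofPred_eq] at ha ⊢
    have h : (a⁻¹).toEquiv = a.toEquiv.symm := rfl
    conv_lhs => rw [← ha]
    rw [h, ← push_trans, LinearEquiv.self_trans_symm, push_refl]

/-- The Lie algebra of a closed subgroup `G` of `GL(m, ℝ)`, as a subspace of `End(ℝᵐ)`: the velocities
at the identity of the smooth curves in `G`. -/
def lieAlg {m : ℕ} (G : Subgroup (GLm m)) : Submodule ℝ (Eu m →L[ℝ] Eu m) where
  carrier := {A | ∃ c : ℝ → (Eu m →L[ℝ] Eu m), ContDiffAt ℝ ∞ c 0 ∧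
    (∀ᶠ t in 𝓝 (0 : ℝ), ∃ g ∈ G, (g : Eu m →L[ℝ] Eu m) = c t) ∧ c 0 = 1 ∧ HasDerivAt c A 0}
  zero_mem' := ⟨fun _ => 1, contDiffAt_const, Eventually.of_forall fun _ => ⟨1, G.one_mem, rfl⟩, rfl,
    hasDerivAt_const _ _⟩
  add_mem' := by
    rintro A B ⟨c, hc, hcG, hc1, hcA⟩ ⟨d, hd, hdG, hd1, hdB⟩
    refine ⟨fun t => c t * d t, hc.mul hd, ?_, by simp [hc1, hd1], ?_⟩
    · filter_upwards [hcG, hdG] with t ⟨g, hg, hgt⟩ ⟨k, hk, hkt⟩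
      exact ⟨g * k, G.mul_mem hg hk, by rw [Units.val_mul, hgt, hkt]⟩
    · have h := hcA.mul hdB
      rw [hc1, hd1, mul_one, one_mul] at h
      exact h
  smul_mem' := by
    rintro r A ⟨c, hc, hcG, hc1, hcA⟩
    have hlin : HasDerivAt (fun t : ℝ => r * t) r 0 := by
      simpa using (hasDerivAt_id (0 : ℝ)).const_mul r
    have h0 : r * (0 : ℝ) = 0 := mul_zero r
    refine ⟨fun t => c (r * t), ?_, ?_, by simpa using hc1, ?_⟩
    · refine ContDiffAt.comp (g := c) (f := fun t : ℝ => r * t) 0 ?_ (by fun_prop)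
      simpa using hc
    · have : Tendsto (fun t : ℝ => r * t) (𝓝 0) (𝓝 0) := by
        simpa using hlin.continuousAt.tendsto
      exact this.eventually hcG
    · exact HasDerivAt.scomp (g₁ := c) (h := fun t : ℝ => r * t) 0 (by simpa using hcA) hlin

/-- `𝔪` is a complement that makes `G` a reductive Lie subgroup of `GL(m, ℝ)`: one has
`𝔤𝔩(m, ℝ) = 𝔤 ⊕ 𝔪`, and `𝔪` is invariant under `Ad_a : C ↦ a C a⁻¹` for all `a ∈ G`. -/
def IsReductiveComplement {m : ℕ} (G : Subgroup (GLm m)) (𝔪 : Submodule ℝ (Eu m →L[ℝ] Eu m)) :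
    Prop :=
  IsCompl (lieAlg G) 𝔪 ∧
    ∀ a ∈ G, ∀ C ∈ 𝔪, (a : Eu m →L[ℝ] Eu m) * C * ((a⁻¹ : GLm m) : Eu m →L[ℝ] Eu m) ∈ 𝔪

/-! ### The bundle of linear frames -/

section Frames

variable (m : ℕ) (M : Type*) [TopologicalSpace M] [ChartedSpace (Eu m) M] [IsManifold (𝓡 m) ∞ M]

/-- The total space of the vector bundle over `M` with fibre `Hom(ℝᵐ, T_x M)` over `x`. -/
abbrev HomTotal : Type _ :=
  Bundle.TotalSpace (Eu m →L[ℝ] Eu m)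
    (fun x : M => Bundle.Trivial M (Eu m) x →L[ℝ] TangentSpace (𝓡 m) x)

/-- The linear frames `u : ℝᵐ ≃ T_x M`, as an open subset of the manifold `HomTotal m M`. -/
def frames : TopologicalSpace.Opens (HomTotal m M) where
  carrier := {p | p.2.IsInvertible}
  is_open' := by
    rw [isOpen_iff_forall_mem_open]
    intro p hp
    let e := trivializationAt (Eu m →L[ℝ] Eu m)
      (fun x : M => Bundle.Trivial M (Eu m) x →L[ℝ] TangentSpace (𝓡 m) x) p.1
    have key : ∀ q ∈ e.source, ((e q).2.IsInvertible ↔ q.2.IsInvertible) := by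
      intro q hq
      have hq' : q.1 ∈ e.baseSet := e.mem_source.1 hq
      rw [hom_trivializationAt_baseSet] at hq'
      rw [hom_trivializationAt_apply, ContinuousLinearMap.inCoordinates_eq hq'.1 hq'.2]
      simp
    refine ⟨e.source ∩ e ⁻¹' {y | y.2.IsInvertible}, fun q hq => (key q hq.1).1 hq.2, ?_,
      FiberBundle.mem_trivializationAt_proj_source, (key p FiberBundle.mem_trivializationAt_proj_source).2 hp⟩
    refine e.continuousOn.isOpen_inter_preimage e.open_source ?_
    exact (ContinuousLinearEquiv.isOpen (𝕜 := ℝ) (E := Eu m) (F := Eu m)).preimage continuous_snd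

/-- The bundle `LM` of linear frames of `M`, with its structure of smooth manifold. -/
abbrev LM : Type _ := frames m M

/-- The model with corners of the manifold `LM`. -/
abbrev JL := (𝓡 m).prod 𝓘(ℝ, Eu m →L[ℝ] Eu m)

instance : IsManifold (JL m) ∞ (LM m M) := inferInstance

instance : IsManifold (JL m) 1 (LM m M) := IsManifold.of_le (n := ∞) (by exact_mod_cast le_top)

variable {m M}

/-- The bundle projection `π : LM → M`. -/
def proj (u : LM m M) : M := u.1.1

/-- A linear frame `u` as a linear isomorphism of `ℝᵐ` onto the tangent space at `π u`. -/
def LM.toEquiv (u : LM m M) : Eu m ≃ₗ[ℝ] TangentSpace (𝓡 m) (proj u) :=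
  (Classical.choose u.2).toLinearEquiv

theorem LM.toEquiv_apply (u : LM m M) (v : Eu m) : u.toEquiv v = u.1.2 v :=
  congrArg (fun f : Eu m →L[ℝ] TangentSpace (𝓡 m) (proj u) => f v) (Classical.choose_spec u.2)

/-- The right action of `GL(m, ℝ)` on the frame bundle, `u · a = u ∘ a`. -/
def act (u : LM m M) (a : GLm m) : LM m M :=
  ⟨⟨u.1.1, u.1.2.comp (a : Eu m →L[ℝ] Eu m)⟩,
    ContinuousLinearMap.IsInvertible.comp u.2 ⟨ContinuousLinearEquiv.unitsEquiv ℝ (Eu m) a, rfl⟩⟩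

theorem toEquiv_act (u : LM m M) (a : GLm m) : (act u a).toEquiv = a.toEquiv.trans u.toEquiv := by
  ext v
  rw [LM.toEquiv_apply]
  exact (u.toEquiv_apply _).symm

/-- `GL(m, ℝ)` acts transitively on the fibres of the frame bundle. -/
theorem exists_act (u v : LM m M) (h : proj v = proj u) : ∃ a : GLm m, v = act u a := by
  obtain ⟨⟨x, f⟩, hf⟩ := u
  obtain ⟨⟨y, g⟩, hg⟩ := v
  obtain rfl : y = x := h
  obtain ⟨e, he⟩ : f.IsInvertible := hf
  obtain ⟨k, rfl⟩ : g.IsInvertible := hg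
  subst he
  refine ⟨(ContinuousLinearEquiv.unitsEquiv ℝ (Eu m)).symm (ContinuousLinearEquiv.trans k e.symm), ?_⟩
  refine Subtype.ext ?_
  refine congrArg (Bundle.TotalSpace.mk y) ?_
  ext1 w
  exact (e.apply_symm_apply (k w)).symm

/-- The frame at `x` given by the preferred chart at `x`. -/
def frameAt (x : M) : LM m M :=
  ⟨⟨x, (((trivializationAt (Eu m) (TangentSpace (𝓡 m) : M → Type _) x).continuousLinearEquivAt ℝ x
      (FiberBundle.mem_baseSet_trivializationAt' x)).symm :
        Eu m →L[ℝ] TangentSpace (𝓡 m) x)⟩, ⟨_, rfl⟩⟩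

theorem proj_frameAt (x : M) : proj (frameAt x : LM m M) = x := rfl

/-! ### `G`-structures -/

/-- A `G`-structure on `M`: a principal subbundle `P(M, G)` of the frame bundle `LM`. The subset `P`
of `LM` is stable under `G`, the group `G` acts transitively on the fibres of `P → M` (the action is
free already on `LM`), and `P` is locally trivial: every point of `M` has an open neighbourhood `U`
with a smooth local section `σ` of `LM` that takes its values in `P`, so that the trivialization
`(y, a) ↦ σ(y) · a` of `LM` over `U` restricts to a trivialization `U × G ≃ P ∩ π⁻¹(U)`. -/
structure GStructure (m : ℕ) (M : Type*) [TopologicalSpace M] [ChartedSpace (Eu m) M]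
    [IsManifold (𝓡 m) ∞ M] (G : Subgroup (GLm m)) where
  carrier : Set (LM m M)
  act_mem : ∀ u ∈ carrier, ∀ a ∈ G, act u a ∈ carrier
  exists_eq_act : ∀ u ∈ carrier, ∀ v ∈ carrier, proj v = proj u → ∃ a ∈ G, v = act u a
  exists_section : ∀ x : M, ∃ U : Set M, IsOpen U ∧ x ∈ U ∧ ∃ σ : M → LM m M,
    ContMDiffOn (𝓡 m) (JL m) ∞ σ U ∧ ∀ y ∈ U, proj (σ y) = y ∧ σ y ∈ carrier

/-! ### Tensors on `M` as an associated bundle of `LM` -/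

variable (m M) in
/-- The bundle of tensors over the tangent spaces of `M`, as a set of pairs `(x, t)`. -/
abbrev TensorBundle : Type _ := Σ x : M, Tensors (TangentSpace (𝓡 m) x)

/-- The class `[u, f]` of `u ∈ LM` and a tensor `f` over `ℝᵐ`, under the identification of the
tensor bundle with the bundle associated with `LM`: the image of `f` under the isomorphism of tensor
algebras induced by `u : ℝᵐ ≃ T_{π u} M`. -/
def assoc (u : LM m M) (f : Tensors (Eu m)) : TensorBundle m M := ⟨proj u, push u.toEquiv f⟩

theorem assoc_act (u : LM m M) (a : GLm m) (f : Tensors (Eu m)) :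
    assoc (act u a) f = assoc u (push a.toEquiv f) := by
  refine Sigma.ext rfl (heq_of_eq ?_)
  change push (act u a).toEquiv f = push u.toEquiv (push a.toEquiv f)
  rw [toEquiv_act]
  exact push_trans _ _ _

theorem assoc_injective (u : LM m M) {f g : Tensors (Eu m)} (h : assoc u f = assoc u g) : f = g := by
  have h' : push u.toEquiv f = push u.toEquiv g := eq_of_heq (Sigma.mk.inj h).2
  have := congrArg (push u.toEquiv.symm) h'
  rwa [← push_trans, ← push_trans, LinearEquiv.self_trans_symm, push_refl, push_refl] at this

theorem exists_assoc_eq (u : LM m M) (t : TensorBundle m M) (h : proj u = t.1) :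
    ∃ f, assoc u f = t := by
  obtain ⟨x, t⟩ := t
  obtain rfl : proj u = x := h
  refine ⟨push u.toEquiv.symm t, ?_⟩
  refine Sigma.ext rfl (heq_of_eq ?_)
  change push u.toEquiv (push u.toEquiv.symm t) = t
  rw [← push_trans, LinearEquiv.symm_trans_self, push_refl]

open Classical in
/-- The map of the tensor bundle induced by a map `Ψ` of frames, `[u, f] ↦ [Ψ u, f]`. The
representative `(u, f)` is chosen with `u` in the set `S` of frames (where `Ψ` is given); for an
equivariant `Ψ` the choice does not matter. -/
def inducedMap (S : Set (LM m M)) (Ψ : LM m M → LM m M) (t : TensorBundle m M) : TensorBundle m M :=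
  if h : ∃ uf : LM m M × Tensors (Eu m), uf.1 ∈ S ∧ assoc uf.1 uf.2 = t then
    assoc (Ψ h.choose.1) h.choose.2
  else t

theorem inducedMap_assoc (S : Set (LM m M)) (Ψ : LM m M → LM m M)
    (hΨ : ∀ u ∈ S, ∀ a : GLm m, act u a ∈ S → Ψ (act u a) = act (Ψ u) a)
    (u : LM m M) (hu : u ∈ S) (f : Tensors (Eu m)) :
    inducedMap S Ψ (assoc u f) = assoc (Ψ u) f := by
  have h : ∃ uf : LM m M × Tensors (Eu m), uf.1 ∈ S ∧ assoc uf.1 uf.2 = assoc u f :=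
    ⟨(u, f), hu, rfl⟩
  rw [inducedMap, dif_pos h]
  obtain ⟨h1, h2⟩ := h.choose_spec
  generalize h.choose = vg at h1 h2
  obtain ⟨v, g⟩ := vg
  obtain ⟨a, rfl⟩ := exists_act u v (congrArg Sigma.fst h2)
  simp only at h1 h2 ⊢
  rw [assoc_act] at h2
  rw [hΨ u hu a h1, assoc_act, assoc_injective u h2]

theorem exists_inducedTensor {T : Tensors (Eu m)} (P : GStructure m M (stabilizer T)) (x : M) :
    ∃ t : Tensors (TangentSpace (𝓡 m) x), ∃ u ∈ P.carrier, assoc u T = ⟨x, t⟩ := by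
  obtain ⟨U, -, hx, σ, -, h⟩ := P.exists_section x
  obtain ⟨h1, h2⟩ := h x hx
  generalize σ x = u at h1 h2
  subst h1
  exact ⟨_, u, h2, rfl⟩

/-- The tensor field `K` on `M` defined by a tensor `T` over `ℝᵐ` and a `G`-structure `P`, where `G`
is the invariance group of `T`: `K_x` is the image of `T` under a frame `u ∈ P` with `π u = x`. -/
def inducedTensorField {T : Tensors (Eu m)} (P : GStructure m M (stabilizer T)) (x : M) :
    Tensors (TangentSpace (𝓡 m) x) :=
  (exists_inducedTensor P x).choose

/-- `K_x` does not depend on the choice of the frame. -/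
theorem inducedTensorField_proj {T : Tensors (Eu m)} (P : GStructure m M (stabilizer T))
    (u : LM m M) (hu : u ∈ P.carrier) : inducedTensorField P (proj u) = push u.toEquiv T := by
  obtain ⟨v, hv, h⟩ := (exists_inducedTensor P (proj u)).choose_spec
  obtain ⟨a, ha, rfl⟩ := P.exists_eq_act u hu v hv (congrArg Sigma.fst h)
  rw [assoc_act, show push a.toEquiv T = T from ha] at h
  exact (eq_of_heq (Sigma.mk.inj h).2).symm

/-! ### Generalized automorphisms -/

/-- A principal automorphism of `LM`: a diffeomorphism that commutes with the action of
`GL(m, ℝ)`. -/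
def IsPrincipalAutomorphism (Φ : LM m M ≃ₘ⟮JL m, JL m⟯ LM m M) : Prop :=
  ∀ (u : LM m M) (a : GLm m), Φ (act u a) = act (Φ u) a

/-- The automorphism `Φ` of `LM` maps `P` into (equivalently, onto) itself. -/
def IsGeneralizedAutomorphism {G : Subgroup (GLm m)} (P : GStructure m M G)
    (Φ : LM m M ≃ₘ⟮JL m, JL m⟯ LM m M) : Prop :=
  MapsTo Φ P.carrier P.carrier

/-- The map `φ : M → M` induced by an automorphism `Φ` of `LM`, `φ ∘ π = π ∘ Φ`. -/
def baseMap (Φ : LM m M → LM m M) (x : M) : M := proj (Φ (frameAt x))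

/-- The automorphism `Φ` of `LM` leaves the tensor field `K` invariant: the induced map of the
tensor bundle, `[u, f] ↦ [Φ u, f]`, carries `K_x` to `K_{φ x}` for all `x`. -/
def LeavesInvariant (Φ : LM m M ≃ₘ⟮JL m, JL m⟯ LM m M) (K : ∀ x : M, Tensors (TangentSpace (𝓡 m) x)) :
    Prop :=
  ∀ x : M, inducedMap univ Φ ⟨x, K x⟩ = ⟨baseMap Φ x, K (baseMap Φ x)⟩

end Frames

/-! ### Local flows -/

section Flow

variable {E : Type*} [NormedAddCommGroup E] [NormedSpace ℝ E] {H : Type*} [TopologicalSpace H]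
  (I : ModelWithCorners ℝ E H) {N : Type*} [TopologicalSpace N] [ChartedSpace H N]

/-- An integral curve of the vector field `X` that stays in `S` leads from `p` to `q` in time `t`. -/
def FlowsTo (S : Set N) (X : ∀ p : N, TangentSpace I p) (t : ℝ) (p q : N) : Prop :=
  ∃ (γ : ℝ → N) (a b : ℝ), 0 ∈ Ioo a b ∧ t ∈ Ioo a b ∧ IsMIntegralCurveOn γ X (Ioo a b) ∧
    (∀ s ∈ Ioo a b, γ s ∈ S) ∧ γ 0 = p ∧ γ t = q

open Classical in
/-- The local flow of the vector field `X`, with integral curves in `S`; it has the junk value `p`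
where the flow is not defined. -/
def localFlow (S : Set N) (X : ∀ p : N, TangentSpace I p) (t : ℝ) (p : N) : N :=
  if h : ∃ q, FlowsTo I S X t p q then h.choose else p

end Flow

/-! ### Invariant vector fields and Lie derivatives -/

section Lie

variable {m : ℕ} {M : Type*} [TopologicalSpace M] [ChartedSpace (Eu m) M] [IsManifold (𝓡 m) ∞ M]

/-- `Ξ` is a smooth vector field on `LM` that is invariant under the action of `GL(m, ℝ)`. -/
def IsInvariantVectorField (Ξ : ∀ u : LM m M, TangentSpace (JL m) u) : Prop :=
  ContMDiff (JL m) (JL m).tangent ∞ (fun u => (⟨u, Ξ u⟩ : TangentBundle (JL m) (LM m M))) ∧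
    ∀ (a : GLm m) (u : LM m M),
      mfderiv (JL m) (JL m) (fun v : LM m M => act v a) u (Ξ u) = Ξ (act u a)

/-- The vector field `ξ` on `M` on which the invariant vector field `Ξ` projects,
`ξ ∘ π = Tπ ∘ Ξ`. -/
def projField (Ξ : ∀ u : LM m M, TangentSpace (JL m) u) (x : M) : TangentSpace (𝓡 m) x :=
  mfderiv (JL m) (𝓡 m) (proj : LM m M → M) (frameAt x) (Ξ (frameAt x))

/-- The flow of `Ξ` consists of (local) generalized automorphisms of `P`: it carries points of `P`
to points of `P`, for all times for which it is defined. -/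
def IsInfinitesimalGeneralizedAutomorphism {G : Subgroup (GLm m)} (P : GStructure m M G)
    (Ξ : ∀ u : LM m M, TangentSpace (JL m) u) : Prop :=
  ∀ (t : ℝ) (p q : LM m M), p ∈ P.carrier → FlowsTo (JL m) univ Ξ t p q → q ∈ P.carrier

/-- The tensor `L` at `x` is the derivative at `t = 0` of `(Φ_{-t})_λ ∘ K ∘ φ_t (x)`, where `φ_t` is
the flow of the vector field `ξ` on `M`, and `(Φ_t)_λ` is the map of the tensor bundle induced by the
flow `Φ_t` of the vector field `X`, which is given on the set `S` of frames. -/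
def HasDerivAlong (S : Set (LM m M)) (X : ∀ u : LM m M, TangentSpace (JL m) u)
    (ξ : ∀ x : M, TangentSpace (𝓡 m) x) (K : ∀ x : M, Tensors (TangentSpace (𝓡 m) x))
    (x : M) (L : Tensors (TangentSpace (𝓡 m) x)) : Prop :=
  ∃ f : ℝ → Tensors (TangentSpace (𝓡 m) x),
    (∀ᶠ t in 𝓝 (0 : ℝ),
      inducedMap S (localFlow (JL m) S X (-t))
        ⟨localFlow (𝓡 m) univ ξ t x, K (localFlow (𝓡 m) univ ξ t x)⟩ = ⟨x, f t⟩) ∧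
    HasTensorDerivAt f L 0

/-- The Lie derivative `£_Ξ K` of the tensor field `K` (as a section of a gauge-natural bundle) with
respect to the invariant vector field `Ξ` exists at `x`, and its value is `L`. -/
def HasLieDerivAt (Ξ : ∀ u : LM m M, TangentSpace (JL m) u)
    (K : ∀ x : M, Tensors (TangentSpace (𝓡 m) x)) (x : M) (L : Tensors (TangentSpace (𝓡 m) x)) :
    Prop :=
  HasDerivAlong univ Ξ (projField Ξ) K x L

/-- The tangent space `T_u P` of a subbundle `P ⊆ LM`: the velocities of the smooth curves in `P`. -/
def tangentTo {G : Subgroup (GLm m)} (P : GStructure m M G) (u : LM m M) :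
    Set (TangentSpace (JL m) u) :=
  {v | ∃ c : ℝ → LM m M, ContMDiffAt 𝓘(ℝ, ℝ) (JL m) ∞ c 0 ∧ (∀ᶠ t in 𝓝 (0 : ℝ), c t ∈ P.carrier) ∧
    tangentMap 𝓘(ℝ, ℝ) (JL m) c ⟨0, (1 : ℝ)⟩ = ⟨u, v⟩}

/-- The space `𝓜_u` of the values at `u` of the fundamental vector fields of the elements of `𝔪`;
the fundamental vector field of `C` at `u` is the image of `C` under the differential at the identity
of `GL(m, ℝ) → LM`, `a ↦ u · a`. -/
def transverse (𝔪 : Submodule ℝ (Eu m →L[ℝ] Eu m)) (u : LM m M) : Set (TangentSpace (JL m) u) :=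
  {v | ∃ C ∈ 𝔪, tangentMap 𝓘(ℝ, Eu m →L[ℝ] Eu m) (JL m) (fun a : GLm m => act u a) ⟨1, C⟩ = ⟨u, v⟩}

open Classical in
/-- The generalized Kosmann vector field `Ξ_K` on `P` associated with `Ξ`: the component of `Ξ` in
`T_u P` with respect to the decomposition `T_u LM = T_u P ⊕ 𝓜_u` at the points `u` of `P`. -/
def kosmann {G : Subgroup (GLm m)} (P : GStructure m M G) (𝔪 : Submodule ℝ (Eu m →L[ℝ] Eu m))
    (Ξ : ∀ u : LM m M, TangentSpace (JL m) u) (u : LM m M) : TangentSpace (JL m) u :=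
  if h : ∃ v : TangentSpace (JL m) u, v ∈ tangentTo P u ∧ Ξ u - v ∈ transverse 𝔪 u then h.choose
  else 0

/-- The `G`-reductive Lie derivative `£^G_Ξ K` of the tensor field `K` with respect to the invariant
vector field `Ξ` exists at `x`, and its value is `L`. It is taken along the flow of `Ξ_K` on `P` and
the flow of the projection `ξ` of `Ξ`. -/
def HasReductiveLieDerivAt {G : Subgroup (GLm m)} (P : GStructure m M G)
    (𝔪 : Submodule ℝ (Eu m →L[ℝ] Eu m)) (Ξ : ∀ u : LM m M, TangentSpace (JL m) u)
    (K : ∀ x : M, Tensors (TangentSpace (𝓡 m) x)) (x : M) (L : Tensors (TangentSpace (𝓡 m) x)) :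
    Prop :=
  HasDerivAlong P.carrier (kosmann P 𝔪 Ξ) (projField Ξ) K x L

end Lie

end GStr

end

/-! Everything rests on one remark. Write `[u, f]` for the image of the tensor `f` over `ℝᵐ` under
the frame `u`. As `G` is the whole stabilizer of `T`, a frame `u` lies in `P` exactly when `[u, T]`
is the value of `K` at `π u` (`mem_carrier_iff`). Membership in `P` thus becomes an equation between
tensors.

An automorphism `Φ` induces `[u, f] ↦ [Φ u, f]`, so for `u ∈ P` it carries `K` at `π u` to `[Φ u,
T]`. This equals `K` at `π (Φ u)` exactly when `Φ u ∈ P`, which gives (1).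

For (2), write `K` along an integral curve `γ` of `Ξ` as `[γ s, g s]`. Transport by the flow back to
`γ s` turns `K` into `[γ s, g (s + t)]`, so the Lie derivative vanishes along the curve exactly when
`g' = 0`. If `g` is constant and `γ 0 ∈ P`, then `g = T` throughout and `γ` stays in `P`;
conversely, a curve in `P` has `g = T`.

The same computation gives (3), once the Kosmann field is known to be equivariant, to lie over `ξ`
and to have integral curves inside `P` (`isFieldOver_kosmann`, `exists_integralCurve_kosmann`).
Relative to a section `σ` with values in `P`, an invariant field has matrix part `Θ · a` at `σ(y) ·
a`, and `Ad`-invariance of `𝔪` makes the matrix part of the Kosmann field `pr Θ · a`, where `pr` is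
the projection onto `𝔤` along `𝔪`. Its integral curves are therefore `σ(y t) · a t`, with `y` an
integral curve of `ξ` and `a' = (pr Θ) a`. Such an `a` stays in `G` because `a⁻¹ T` has derivative
zero.

`P` is only a set of frames, and the Kosmann field has no prescribed meaning off `P`. Uniqueness of
its flow is therefore deduced from uniqueness on `M` together with equivariance
(`eqOn_of_proj_eqOn`). -/

noncomputable section

namespace GStr

/-! ### Smooth coordinates on the frame bundle -/

section FrameCoordinates

variable {m : ℕ} {M : Type*} [TopologicalSpace M] [ChartedSpace (Eu m) M] [IsManifold (𝓡 m) ∞ M]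

/-! ### Units of the endomorphism ring -/

open Classical in
/-- An invertible endomorphism as an element of `GL(m, ℝ)`; the junk value is `1`. -/
def toGL (B : Eu m →L[ℝ] Eu m) : GLm m := if h : IsUnit B then h.unit else 1

theorem toGL_val {B : Eu m →L[ℝ] Eu m} (h : IsUnit B) : (toGL B : Eu m →L[ℝ] Eu m) = B := by
  rw [toGL, dif_pos h]; rfl

@[simp] theorem toGL_coe (a : GLm m) : toGL (a : Eu m →L[ℝ] Eu m) = a :=
  Units.ext (toGL_val a.isUnit)

theorem eventually_isUnit {B : Eu m →L[ℝ] Eu m} (h : IsUnit B) : ∀ᶠ C in 𝓝 B, IsUnit C :=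
  Units.isOpen.mem_nhds h

/-- On the open set of invertible endomorphisms, `toGL` is the inverse of the open embedding that
defines the manifold structure of the group of units. -/
theorem contMDiffAt_toGL {B : Eu m →L[ℝ] Eu m} (h : IsUnit B) :
    ContMDiffAt 𝓘(ℝ, Eu m →L[ℝ] Eu m) 𝓘(ℝ, Eu m →L[ℝ] Eu m) ∞ (toGL : _ → GLm m) B := by
  have h1 := contMDiffOn_isOpenEmbedding_symm (I := 𝓘(ℝ, Eu m →L[ℝ] Eu m)) (n := ∞)
    (Units.isOpenEmbedding_val (R := Eu m →L[ℝ] Eu m))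
  have hB : range (Units.val : GLm m → _) ∈ 𝓝 B :=
    Units.isOpenEmbedding_val.isOpen_range.mem_nhds ⟨h.unit, rfl⟩
  refine (h1.contMDiffAt hB).congr_of_eventuallyEq ?_
  filter_upwards [hB] with C hC
  obtain ⟨a, rfl⟩ := hC
  rw [toGL_coe]
  exact (Topology.IsOpenEmbedding.toOpenPartialHomeomorph_left_inv
    (h := Units.isOpenEmbedding_val (R := Eu m →L[ℝ] Eu m))).symm

/-! ### The action and the projection -/

theorem proj_act (u : LM m M) (a : GLm m) : proj (act u a) = proj u := rfl

theorem act_one (u : LM m M) : act u 1 = u := rfl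

theorem act_act (u : LM m M) (a b : GLm m) : act (act u a) b = act u (a * b) := rfl

theorem act_left_injective (u : LM m M) {a b : GLm m} (h : act u a = act u b) : a = b := by
  refine Units.ext (ContinuousLinearMap.ext fun v => u.toEquiv.injective ?_)
  have key : ∀ c : GLm m, u.toEquiv ((c : Eu m →L[ℝ] Eu m) v) = (act u c).1.2 v :=
    fun c => u.toEquiv_apply _
  have h2 : HEq ((act u a).1.2) ((act u b).1.2) := by rw [h]
  have h3 : (act u a).1.2 = (act u b).1.2 := eq_of_heq h2
  exact (key a).trans ((congrArg (fun f => f v) h3).trans (key b).symm)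

theorem contMDiff_proj : ContMDiff (JL m) (𝓡 m) ∞ (proj : LM m M → M) :=
  (Bundle.contMDiff_proj _).comp contMDiff_subtype_val

theorem mdifferentiableAt_proj (u : LM m M) : MDifferentiableAt (JL m) (𝓡 m) proj u :=
  contMDiff_proj.mdifferentiableAt (by simp)

variable (M) in
/-- The local trivialization of the bundle `Hom(ℝᵐ, TM)` near `x₀`. -/
abbrev homTriv (x₀ : M) := trivializationAt (Eu m →L[ℝ] Eu m)
      (fun x : M => Bundle.Trivial M (Eu m) x →L[ℝ] TangentSpace (𝓡 m) x) x₀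

/-- The matrix of the frame `u` with respect to the coordinates near `x₀`. -/
def frameMatrix (x₀ : M) (u : LM m M) : Eu m →L[ℝ] Eu m := (homTriv M x₀ u.1).2

theorem frameMatrix_act (x₀ : M) (u : LM m M) (a : GLm m) :
    frameMatrix x₀ (act u a) = frameMatrix x₀ u * a := by
  unfold frameMatrix homTriv
  rw [hom_trivializationAt_apply, hom_trivializationAt_apply]
  ext v
  simp [act, ContinuousLinearMap.inCoordinates]

theorem isUnit_frameMatrix (x₀ : M) (u : LM m M) (hu : proj u ∈ (homTriv M x₀ (m := m)).baseSet) :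
    IsUnit (frameMatrix x₀ u) := by
  unfold frameMatrix homTriv
  rw [hom_trivializationAt_baseSet] at hu
  change u.1.1 ∈ _ ∧ u.1.1 ∈ _ at hu
  rw [hom_trivializationAt_apply, ContinuousLinearMap.inCoordinates_eq hu.1 hu.2]
  obtain ⟨e, he⟩ := u.2
  rw [← he]
  exact ⟨(ContinuousLinearEquiv.unitsEquiv ℝ (Eu m)).symm
    ((((trivializationAt (Eu m) (Bundle.Trivial M (Eu m)) x₀).continuousLinearEquivAt ℝ _
      hu.1).symm.trans e).trans
        ((trivializationAt (Eu m) (TangentSpace (𝓡 m)) x₀).continuousLinearEquivAt ℝ _ hu.2)), rfl⟩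

/-- `LM` is open in the total space of a smooth vector bundle, so smoothness can be tested in a
local trivialization of that bundle. -/
theorem contMDiffAt_LM_iff {E H : Type*} [NormedAddCommGroup E] [NormedSpace ℝ E]
    [TopologicalSpace H] {I : ModelWithCorners ℝ E H} {N : Type*} [TopologicalSpace N]
    [ChartedSpace H N] {f : N → LM m M} {p : N} {x₀ : M}
    (h : proj (f p) ∈ (homTriv M x₀ (m := m)).baseSet) :
    ContMDiffAt I (JL m) ∞ f p ↔ ContMDiffAt I (𝓡 m) ∞ (fun q => proj (f q)) p ∧
      ContMDiffAt I 𝓘(ℝ, Eu m →L[ℝ] Eu m) ∞ (fun q => frameMatrix x₀ (f q)) p := by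
  rw [← ContMDiffAt.subtypeVal_comp_iff]
  exact (homTriv M x₀).contMDiffAt_iff ((homTriv M x₀).mem_source.2 h)

theorem mem_baseSet_homTriv (x : M) : x ∈ (homTriv M x (m := m)).baseSet :=
  FiberBundle.mem_baseSet_trivializationAt' x

/-- The action of `GL(m, ℝ)` on the frame bundle is smooth. -/
theorem contMDiff_act : ContMDiff ((JL m).prod 𝓘(ℝ, Eu m →L[ℝ] Eu m)) (JL m) ∞
    (fun p : LM m M × GLm m => act p.1 p.2) := by
  intro p
  have h0 := mem_baseSet_homTriv (m := m) (proj p.1)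
  have h1 := (contMDiffAt_LM_iff (p := p.1) (f := fun u : LM m M => u) (I := JL m) h0).1
    contMDiffAt_id
  have hp : ContMDiffAt ((JL m).prod 𝓘(ℝ, Eu m →L[ℝ] Eu m)) (𝓡 m) ∞
      (fun q : LM m M × GLm m => proj q.1) p := h1.1.comp p contMDiffAt_fst
  refine (contMDiffAt_LM_iff (f := fun q : LM m M × GLm m => act q.1 q.2) h0).2 ⟨hp, ?_⟩
  simp only [frameMatrix_act]
  have h2 : ContMDiffAt ((JL m).prod 𝓘(ℝ, Eu m →L[ℝ] Eu m)) 𝓘(ℝ, Eu m →L[ℝ] Eu m) ∞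
      (fun q : LM m M × GLm m => frameMatrix (proj p.1) q.1) p := h1.2.comp p contMDiffAt_fst
  have h3 : ContMDiffAt ((JL m).prod 𝓘(ℝ, Eu m →L[ℝ] Eu m)) 𝓘(ℝ, Eu m →L[ℝ] Eu m) ∞
      (fun q : LM m M × GLm m => (q.2 : Eu m →L[ℝ] Eu m)) p :=
    ContMDiffAt.comp (g := (Units.val : GLm m → Eu m →L[ℝ] Eu m))
      (I' := 𝓘(ℝ, Eu m →L[ℝ] Eu m)) p Units.contMDiff_val.contMDiffAt contMDiffAt_snd
  exact h2.clm_comp h3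

theorem contMDiff_act_right (a : GLm m) :
    ContMDiff (JL m) (JL m) ∞ (fun u : LM m M => act u a) :=
  contMDiff_act.comp (contMDiff_id.prodMk contMDiff_const)

theorem contMDiff_act_left (u : LM m M) :
    ContMDiff 𝓘(ℝ, Eu m →L[ℝ] Eu m) (JL m) ∞ (fun a : GLm m => act u a) :=
  contMDiff_act.comp (contMDiff_const.prodMk contMDiff_id)

theorem mdifferentiableAt_act_right (a : GLm m) (u : LM m M) :
    MDifferentiableAt (JL m) (JL m) (fun v : LM m M => act v a) u :=
  (contMDiff_act_right a).mdifferentiableAt (by simp)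

/-! ### Coordinates with respect to a local section -/

open Classical in
/-- The element `a` of `GL(m, ℝ)` with `u = σ(π u) · a`. -/
def coord (σ : M → LM m M) (u : LM m M) : GLm m :=
  if h : ∃ a, u = act (σ (proj u)) a then h.choose else 1

theorem act_coord (σ : M → LM m M) (u : LM m M) (h : proj (σ (proj u)) = proj u) :
    act (σ (proj u)) (coord σ u) = u := by
  have h' := exists_act (σ (proj u)) u h.symm
  rw [coord, dif_pos h']
  exact h'.choose_spec.symm

theorem coord_eq {σ : M → LM m M} {y : M} (h : proj (σ y) = y) (a : GLm m) :
    coord σ (act (σ y) a) = a := by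
  have h1 : proj (act (σ y) a) = y := h
  have h2 := act_coord σ (act (σ y) a) (by rw [h1, h])
  rw [h1] at h2
  exact act_left_injective _ h2

theorem coord_act (σ : M → LM m M) (u : LM m M) (h : proj (σ (proj u)) = proj u) (a : GLm m) :
    coord σ (act u a) = coord σ u * a := by
  conv_lhs => rw [← act_coord σ u h, act_act]
  exact coord_eq h _

/-- A smooth local section of the frame bundle over the open set `U`. -/
structure IsLocalSection (U : Set M) (σ : M → LM m M) : Prop where
  isOpen : IsOpen U
  contMDiffOn : ContMDiffOn (𝓡 m) (JL m) ∞ σ U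
  proj_eq : ∀ y ∈ U, proj (σ y) = y

namespace IsLocalSection

variable {U : Set M} {σ : M → LM m M} (hσ : IsLocalSection U σ)
include hσ

theorem act_coord {u : LM m M} (hu : proj u ∈ U) : act (σ (proj u)) (coord σ u) = u :=
  GStr.act_coord σ u (hσ.proj_eq _ hu)

theorem coord_eq {y : M} (hy : y ∈ U) (a : GLm m) : coord σ (act (σ y) a) = a :=
  GStr.coord_eq (hσ.proj_eq _ hy) a

theorem coord_act {u : LM m M} (hu : proj u ∈ U) (a : GLm m) :
    coord σ (act u a) = coord σ u * a :=
  GStr.coord_act σ u (hσ.proj_eq _ hu) a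

theorem preimage_mem_nhds {u : LM m M} (hu : proj u ∈ U) : proj ⁻¹' U ∈ 𝓝 u :=
  contMDiff_proj.continuous.continuousAt.preimage_mem_nhds (hσ.isOpen.mem_nhds hu)

theorem contMDiffAt {y : M} (hy : y ∈ U) : ContMDiffAt (𝓡 m) (JL m) ∞ σ y :=
  hσ.contMDiffOn.contMDiffAt (hσ.isOpen.mem_nhds hy)

/-- In a trivialization, `u = σ(π u) · a` reads as an identity of matrices. Hence `a` is the inverse
of the matrix of `σ(π u)` times the matrix of `u`, and inversion is smooth at units. -/
theorem contMDiffAt_coord {u : LM m M} (hu : proj u ∈ U) :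
    ContMDiffAt (JL m) 𝓘(ℝ, Eu m →L[ℝ] Eu m) ∞
      (fun v : LM m M => (coord σ v : Eu m →L[ℝ] Eu m)) u := by
  set x₀ := proj u
  have h0 := mem_baseSet_homTriv (m := m) x₀
  have h1 := ((contMDiffAt_LM_iff (p := u) (f := fun u : LM m M => u) (I := JL m) h0).1
    contMDiffAt_id).2
  have hs : ContMDiffAt (JL m) (JL m) ∞ (fun v : LM m M => σ (proj v)) u :=
    ContMDiffAt.comp u (hσ.contMDiffAt hu) contMDiff_proj.contMDiffAt
  have hb : proj (σ (proj u)) ∈ (homTriv M x₀ (m := m)).baseSet := by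
    rw [hσ.proj_eq _ hu]; exact h0
  have h2 := ((contMDiffAt_LM_iff (f := fun v : LM m M => σ (proj v)) hb).1 hs).2
  have h3 : ContMDiffAt (JL m) 𝓘(ℝ, Eu m →L[ℝ] Eu m) ∞
      (fun v : LM m M => Ring.inverse (frameMatrix x₀ (σ (proj v)))) u := by
    obtain ⟨B, hB⟩ := isUnit_frameMatrix x₀ _ hb
    have := contDiffAt_ringInverse ℝ (n := ∞) B
    rw [hB] at this
    exact this.contMDiffAt.comp u h2
  refine (h3.clm_comp h1).congr_of_eventuallyEq ?_
  have hbn : ∀ᶠ v in 𝓝 u, proj v ∈ (homTriv M x₀ (m := m)).baseSet :=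
    contMDiff_proj.continuous.continuousAt.preimage_mem_nhds
      ((homTriv M x₀ (m := m)).open_baseSet.mem_nhds h0)
  filter_upwards [hσ.preimage_mem_nhds hu, hbn] with v hv hvb
  have h4 : frameMatrix x₀ v = frameMatrix x₀ (σ (proj v)) * coord σ v := by
    rw [← frameMatrix_act, hσ.act_coord hv]
  have h5 : IsUnit (frameMatrix x₀ (σ (proj v))) :=
    isUnit_frameMatrix x₀ _ (by rw [hσ.proj_eq _ hv]; exact hvb)
  change _ = Ring.inverse (frameMatrix x₀ (σ (proj v))) * frameMatrix x₀ v
  rw [h4, ← mul_assoc, Ring.inverse_mul_cancel _ h5, one_mul]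

theorem mdifferentiableAt_coord {u : LM m M} (hu : proj u ∈ U) :
    MDifferentiableAt (JL m) 𝓘(ℝ, Eu m →L[ℝ] Eu m)
      (fun v : LM m M => (coord σ v : Eu m →L[ℝ] Eu m)) u :=
  (hσ.contMDiffAt_coord hu).mdifferentiableAt (by simp)

/-- The frame with given coordinates depends smoothly on them. -/
theorem contMDiffAt_frame {y : M} (hy : y ∈ U) {B : Eu m →L[ℝ] Eu m} (hB : IsUnit B) :
    ContMDiffAt ((𝓡 m).prod 𝓘(ℝ, Eu m →L[ℝ] Eu m)) (JL m) ∞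
      (fun p : M × (Eu m →L[ℝ] Eu m) => act (σ p.1) (toGL p.2)) (y, B) := by
  have h1 : ContMDiffAt ((𝓡 m).prod 𝓘(ℝ, Eu m →L[ℝ] Eu m)) (JL m) ∞
      (fun p : M × (Eu m →L[ℝ] Eu m) => σ p.1) (y, B) :=
    ContMDiffAt.comp (y, B) (hσ.contMDiffAt hy) contMDiffAt_fst
  have h2 : ContMDiffAt ((𝓡 m).prod 𝓘(ℝ, Eu m →L[ℝ] Eu m)) 𝓘(ℝ, Eu m →L[ℝ] Eu m) ∞
      (fun p : M × (Eu m →L[ℝ] Eu m) => toGL p.2) (y, B) :=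
    ContMDiffAt.comp (y, B) (contMDiffAt_toGL hB) contMDiffAt_snd
  exact contMDiff_act.contMDiffAt.comp (y, B) (h1.prodMk h2)

/-- A tangent vector of the frame bundle is determined by its components in the coordinates. -/
theorem ext_vector {u : LM m M} (hu : proj u ∈ U) {v w : TangentSpace (JL m) u}
    (h1 : mfderiv (JL m) (𝓡 m) proj u v = mfderiv (JL m) (𝓡 m) proj u w)
    (h2 : mfderiv (JL m) 𝓘(ℝ, Eu m →L[ℝ] Eu m)
      (fun v : LM m M => (coord σ v : Eu m →L[ℝ] Eu m)) u v =
      mfderiv (JL m) 𝓘(ℝ, Eu m →L[ℝ] Eu m)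
      (fun v : LM m M => (coord σ v : Eu m →L[ℝ] Eu m)) u w) : v = w := by
  -- Near `u`, passing to coordinates and then back to frames is the identity. By the chain rule the
  -- identity of the tangent space factors through the two components.
  have hf := (hσ.contMDiffAt_frame hu (coord σ u).isUnit).mdifferentiableAt (by simp)
  have hp := (mdifferentiableAt_proj u).hasMFDerivAt.prodMk (hσ.mdifferentiableAt_coord hu).hasMFDerivAt
  have hc := hf.hasMFDerivAt.comp u hp
  have hid := (hasMFDerivAt_id (I := JL m) u).congr_of_eventuallyEq (f₁ := (fun p : M × (Eu m →L[ℝ] Eu m) => act (σ p.1) (toGL p.2)) ∘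
    fun v : LM m M => (proj v, (coord σ v : Eu m →L[ℝ] Eu m))) (by
      filter_upwards [hσ.preimage_mem_nhds hu] with v hv
      simp [hσ.act_coord hv])
  have h3 := hasMFDerivAt_unique hid hc
  refine (congrArg (fun f => f v) h3).trans (Eq.trans ?_ (congrArg (fun f => f w) h3).symm)
  exact congrArg (mfderiv _ _ _ _) (Prod.ext h1 h2 : ((_, _) : Eu m × (Eu m →L[ℝ] Eu m)) = (_, _))

end IsLocalSection

end FrameCoordinates

/-! ### Velocities of curves of frames -/

section Velocities

variable {m : ℕ} {M : Type*} [TopologicalSpace M] [ChartedSpace (Eu m) M] [IsManifold (𝓡 m) ∞ M]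

theorem comp_smulRight_one {E F : Type*} [AddCommGroup E] [Module ℝ E] [TopologicalSpace E]
    [ContinuousSMul ℝ E] [AddCommGroup F] [Module ℝ F] [TopologicalSpace F] [ContinuousSMul ℝ F]
    (L : E →L[ℝ] F) (v : E) :
    L.comp ((1 : ℝ →L[ℝ] ℝ).smulRight v) = (1 : ℝ →L[ℝ] ℝ).smulRight (L v) := by
  apply ContinuousLinearMap.ext_ring
  simp

theorem eq_smulRight_one {E : Type*} [AddCommGroup E] [Module ℝ E] [TopologicalSpace E]
    [ContinuousSMul ℝ E] (L : ℝ →L[ℝ] E) : L = (1 : ℝ →L[ℝ] ℝ).smulRight (L 1) := by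
  apply ContinuousLinearMap.ext_ring
  simp

theorem smulRight_one_injective {E : Type*} [AddCommGroup E] [Module ℝ E] [TopologicalSpace E]
    [ContinuousSMul ℝ E] {v w : E}
    (h : (1 : ℝ →L[ℝ] ℝ).smulRight v = (1 : ℝ →L[ℝ] ℝ).smulRight w) : v = w := by
  simpa using congrArg (fun f => f (1 : ℝ)) h

/-- The differential of the projection of the frame bundle. -/
def dproj (u : LM m M) : TangentSpace (JL m) u →L[ℝ] TangentSpace (𝓡 m) (proj u) :=
  mfderiv (JL m) (𝓡 m) proj u

/-- The differential of the matrix part of the coordinates with respect to a local section. -/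
def dcoord (σ : M → LM m M) (u : LM m M) : TangentSpace (JL m) u →L[ℝ] (Eu m →L[ℝ] Eu m) :=
  mfderiv (JL m) 𝓘(ℝ, Eu m →L[ℝ] Eu m) (fun v : LM m M => (coord σ v : Eu m →L[ℝ] Eu m)) u

/-- The differential of the right translation by `a`. -/
def dact (a : GLm m) (u : LM m M) : TangentSpace (JL m) u →L[ℝ] TangentSpace (JL m) (act u a) :=
  mfderiv (JL m) (JL m) (fun v : LM m M => act v a) u

theorem hasMFDerivAt_proj (u : LM m M) : HasMFDerivAt (JL m) (𝓡 m) proj u (dproj u) :=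
  (mdifferentiableAt_proj u).hasMFDerivAt

theorem hasMFDerivAt_act (a : GLm m) (u : LM m M) :
    HasMFDerivAt (JL m) (JL m) (fun v : LM m M => act v a) u (dact a u) :=
  (mdifferentiableAt_act_right a u).hasMFDerivAt

theorem dproj_dact (a : GLm m) (u : LM m M) (v : TangentSpace (JL m) u) :
    dproj (act u a) (dact a u v) = dproj u v := by
  have h := (hasMFDerivAt_proj (act u a)).comp u (hasMFDerivAt_act a u)
  exact congrArg (fun f => f v) (hasMFDerivAt_unique h (hasMFDerivAt_proj u))

theorem HasMFDerivAt.proj_curve {c : ℝ → LM m M} {t : ℝ} {v : TangentSpace (JL m) (c t)}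
    (h : HasMFDerivAt 𝓘(ℝ, ℝ) (JL m) c t ((1 : ℝ →L[ℝ] ℝ).smulRight v)) :
    HasMFDerivAt 𝓘(ℝ, ℝ) (𝓡 m) (fun s => proj (c s)) t
      ((1 : ℝ →L[ℝ] ℝ).smulRight (dproj (c t) v)) := by
  refine ((hasMFDerivAt_proj (c t)).comp t h).congr_mfderiv ?_
  exact comp_smulRight_one _ _

theorem HasMFDerivAt.act_curve {c : ℝ → LM m M} {t : ℝ} {v : TangentSpace (JL m) (c t)}
    (h : HasMFDerivAt 𝓘(ℝ, ℝ) (JL m) c t ((1 : ℝ →L[ℝ] ℝ).smulRight v)) (a : GLm m) :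
    HasMFDerivAt 𝓘(ℝ, ℝ) (JL m) (fun s => act (c s) a) t
      ((1 : ℝ →L[ℝ] ℝ).smulRight (dact a (c t) v)) := by
  refine ((hasMFDerivAt_act a (c t)).comp t h).congr_mfderiv ?_
  exact comp_smulRight_one _ _

namespace IsLocalSection

variable {U : Set M} {σ : M → LM m M} (hσ : IsLocalSection U σ)
include hσ

theorem hasMFDerivAt_coord {u : LM m M} (hu : proj u ∈ U) :
    HasMFDerivAt (JL m) 𝓘(ℝ, Eu m →L[ℝ] Eu m)
      (fun v : LM m M => (coord σ v : Eu m →L[ℝ] Eu m)) u (dcoord σ u) :=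
  (hσ.mdifferentiableAt_coord hu).hasMFDerivAt

theorem dcoord_dact {u : LM m M} (hu : proj u ∈ U) (a : GLm m) (v : TangentSpace (JL m) u) :
    dcoord σ (act u a) (dact a u v) = dcoord σ u v * a := by
  have hu' : proj (act u a) ∈ U := hu
  have h := (hσ.hasMFDerivAt_coord hu').comp u (hasMFDerivAt_act a u)
  have h1 : HasMFDerivAt 𝓘(ℝ, Eu m →L[ℝ] Eu m) 𝓘(ℝ, Eu m →L[ℝ] Eu m)
      (fun B : Eu m →L[ℝ] Eu m => B * (a : Eu m →L[ℝ] Eu m)) (coord σ u)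
      ((ContinuousLinearMap.compL ℝ (Eu m) (Eu m) (Eu m)).flip (a : Eu m →L[ℝ] Eu m)) :=
    ((ContinuousLinearMap.compL ℝ (Eu m) (Eu m) (Eu m)).flip
      (a : Eu m →L[ℝ] Eu m)).hasFDerivAt.hasMFDerivAt
  have h2 := (h1.comp u (hσ.hasMFDerivAt_coord hu)).congr_of_eventuallyEq
    (f₁ := (fun v : LM m M => (coord σ v : Eu m →L[ℝ] Eu m)) ∘ fun v => act v a) (by
      filter_upwards [hσ.preimage_mem_nhds hu] with v hv
      simp [hσ.coord_act hv])
  exact congrArg (fun f => f v) (hasMFDerivAt_unique h h2)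

theorem hasDerivAt_coord_curve {c : ℝ → LM m M} {t : ℝ} {v : TangentSpace (JL m) (c t)}
    (h : HasMFDerivAt 𝓘(ℝ, ℝ) (JL m) c t ((1 : ℝ →L[ℝ] ℝ).smulRight v)) (ht : proj (c t) ∈ U) :
    HasDerivAt (fun s => (coord σ (c s) : Eu m →L[ℝ] Eu m)) (dcoord σ (c t) v) t := by
  have h1 : HasFDerivAt (fun s => (coord σ (c s) : Eu m →L[ℝ] Eu m))
      ((1 : ℝ →L[ℝ] ℝ).smulRight (dcoord σ (c t) v)) t :=
    (((hσ.hasMFDerivAt_coord ht).comp t h).congr_mfderiv (comp_smulRight_one _ _)).hasFDerivAt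
  exact h1.hasDerivAt.congr_deriv (by simp)

/-- The velocity of a curve of frames, in coordinates. -/
theorem hasMFDerivAt_frame_curve {y : ℝ → M} {B : ℝ → Eu m →L[ℝ] Eu m} {t : ℝ}
    (hyt : y t ∈ U) (hBt : IsUnit (B t))
    {v : TangentSpace (JL m) (act (σ (y t)) (toGL (B t)))}
    (hy : HasMFDerivAt 𝓘(ℝ, ℝ) (𝓡 m) y t ((1 : ℝ →L[ℝ] ℝ).smulRight (dproj _ v : Eu m)))
    (hB : HasDerivAt B (dcoord σ _ v) t) :
    HasMFDerivAt 𝓘(ℝ, ℝ) (JL m) (fun s => act (σ (y s)) (toGL (B s))) t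
      ((1 : ℝ →L[ℝ] ℝ).smulRight v) := by
  set c : ℝ → LM m M := fun s => act (σ (y s)) (toGL (B s)) with hc
  have hd : MDifferentiableAt 𝓘(ℝ, ℝ) (JL m) c t :=
    ((hσ.contMDiffAt_frame hyt hBt).mdifferentiableAt (by simp)).comp (f := fun s => (y s, B s)) t
      (hy.mdifferentiableAt.prodMk hB.differentiableAt.mdifferentiableAt)
  -- The curve has some velocity `w`; it equals `v` because both have the same components in the
  -- coordinates.
  obtain ⟨w, hw⟩ : ∃ w : TangentSpace (JL m) (c t),
      HasMFDerivAt 𝓘(ℝ, ℝ) (JL m) c t ((1 : ℝ →L[ℝ] ℝ).smulRight w) := by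
    refine ⟨mfderiv 𝓘(ℝ, ℝ) (JL m) c t (1 : ℝ), hd.hasMFDerivAt.congr_mfderiv ?_⟩
    exact eq_smulRight_one _
  have hct : proj (c t) = y t := hσ.proj_eq _ hyt
  have hyc : Tendsto y (𝓝 t) (𝓝 (y t)) := hy.continuousAt
  have hUn : ∀ᶠ s in 𝓝 t, y s ∈ U := hyc.eventually (hσ.isOpen.mem_nhds hyt)
  have hBn : ∀ᶠ s in 𝓝 t, IsUnit (B s) := hB.continuousAt.eventually (eventually_isUnit hBt)
  have h1 := HasMFDerivAt.proj_curve hw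
  have h1' := h1.congr_of_eventuallyEq (f₁ := y) (by
    filter_upwards [hUn] with s hs
    exact (hσ.proj_eq _ hs).symm)
  have h2 := (hσ.hasDerivAt_coord_curve hw (by rw [hct]; exact hyt)).congr_of_eventuallyEq
    (f₁ := B) (by
      filter_upwards [hUn, hBn] with s hs hBs
      simp only [hc]
      rw [hσ.coord_eq hs, toGL_val hBs])
  have h3 : w = v := by
    refine hσ.ext_vector (by rw [hct]; exact hyt) ?_ (h2.unique hB)
    have h4 := hasMFDerivAt_unique h1' hy
    exact smulRight_one_injective (E := Eu m) h4
  rwa [h3] at hw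

theorem tangentMap_frame_curve {y : ℝ → M} {B : ℝ → Eu m →L[ℝ] Eu m} {t : ℝ} {u : LM m M}
    (hyt : y t ∈ U) (hBt : IsUnit (B t)) (hu : act (σ (y t)) (toGL (B t)) = u)
    {v : TangentSpace (JL m) u}
    (hy : HasMFDerivAt 𝓘(ℝ, ℝ) (𝓡 m) y t ((1 : ℝ →L[ℝ] ℝ).smulRight (dproj u v : Eu m)))
    (hB : HasDerivAt B (dcoord σ u v) t) :
    tangentMap 𝓘(ℝ, ℝ) (JL m) (fun s => act (σ (y s)) (toGL (B s))) ⟨t, (1 : ℝ)⟩ = ⟨u, v⟩ := by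
  subst hu
  have h := (hσ.hasMFDerivAt_frame_curve hyt hBt hy hB).mfderiv
  refine Bundle.TotalSpace.mk_inj.2 ?_
  rw [h]
  exact one_smul ℝ (v : Eu m × (Eu m →L[ℝ] Eu m))

end IsLocalSection

end Velocities

/-! ### Frames in `P`, equivariant fields and their flows -/

section Flows

variable {m : ℕ} {M : Type*} [TopologicalSpace M] [ChartedSpace (Eu m) M] [IsManifold (𝓡 m) ∞ M]

/-! ### Tensors and the reduction -/

theorem GStructure.exists_localSection {G : Subgroup (GLm m)} (P : GStructure m M G) (x : M) :
    ∃ (U : Set M) (σ : M → LM m M), IsLocalSection U σ ∧ x ∈ U ∧ ∀ y ∈ U, σ y ∈ P.carrier := by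
  obtain ⟨U, hU, hx, σ, hs, h⟩ := P.exists_section x
  exact ⟨U, σ, ⟨hU, hs, fun y hy => (h y hy).1⟩, hx, fun y hy => (h y hy).2⟩

theorem GStructure.exists_mem {G : Subgroup (GLm m)} (P : GStructure m M G) (x : M) :
    ∃ u ∈ P.carrier, proj u = x := by
  obtain ⟨U, σ, hσ, hx, h⟩ := P.exists_localSection x
  exact ⟨σ x, h x hx, hσ.proj_eq x hx⟩

theorem GStructure.act_mem_iff {G : Subgroup (GLm m)} (P : GStructure m M G) {u : LM m M}
    (hu : u ∈ P.carrier) {a : GLm m} : act u a ∈ P.carrier ↔ a ∈ G := by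
  refine ⟨fun h => ?_, P.act_mem u hu a⟩
  obtain ⟨b, hb, h'⟩ := P.exists_eq_act u hu _ h rfl
  rwa [act_left_injective u h']

/-- A frame belongs to `P` if and only if it carries `T` to the tensor field defined by `T`. -/
theorem mem_carrier_iff {T : Tensors (Eu m)} (P : GStructure m M (stabilizer T)) (u : LM m M) :
    u ∈ P.carrier ↔ assoc u T = ⟨proj u, inducedTensorField P (proj u)⟩ := by
  obtain ⟨v, hv, hvu⟩ := P.exists_mem (proj u)
  -- Compare with a frame `v ∈ P` over the same point: `[v · a, T] = [v, a T]` equals `[v, T]`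
  -- exactly when `a` fixes `T`.
  obtain ⟨a, rfl⟩ := exists_act v u hvu.symm
  have h : (⟨proj (act v a), inducedTensorField P (proj (act v a))⟩ : TensorBundle m M) =
      assoc v T := Sigma.ext rfl (heq_of_eq (inducedTensorField_proj P v hv))
  rw [h, P.act_mem_iff hv, assoc_act]
  exact ⟨fun ha => by rw [show push a.toEquiv T = T from ha], fun h => assoc_injective v h⟩

theorem baseMap_proj {Φ : LM m M → LM m M}
    (hΦ : ∀ (u : LM m M) (a : GLm m), Φ (act u a) = act (Φ u) a) (u : LM m M) :
    baseMap Φ (proj u) = proj (Φ u) := by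
  obtain ⟨a, ha⟩ := exists_act u (frameAt (proj u)) rfl
  rw [baseMap, ha, hΦ, proj_act]

theorem isGeneralizedAutomorphism_iff {T : Tensors (Eu m)} (P : GStructure m M (stabilizer T))
    (Φ : LM m M ≃ₘ⟮JL m, JL m⟯ LM m M) (hΦ : IsPrincipalAutomorphism Φ) :
    IsGeneralizedAutomorphism P Φ ↔ LeavesInvariant Φ (inducedTensorField P) := by
  have key : ∀ u ∈ P.carrier, Φ u ∈ P.carrier ↔
      inducedMap univ Φ ⟨proj u, inducedTensorField P (proj u)⟩ =
        ⟨baseMap Φ (proj u), inducedTensorField P (baseMap Φ (proj u))⟩ := by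
    intro u hu
    rw [← (mem_carrier_iff P u).1 hu, inducedMap_assoc univ Φ (fun v _ a _ => hΦ v a) u trivial,
      baseMap_proj hΦ, mem_carrier_iff]
  refine ⟨fun h x => ?_, fun h u hu => (key u hu).2 (h _)⟩
  obtain ⟨u, hu, rfl⟩ := P.exists_mem x
  exact (key u hu).1 (h hu)

/-! ### Equivariant vector fields over a vector field of the base -/

/-- The vector field `X`, given on the set `S` of frames, is equivariant and lies over `ξ`. -/
structure IsFieldOver (S : Set (LM m M)) (X : ∀ u : LM m M, TangentSpace (JL m) u)
    (ξ : ∀ x : M, TangentSpace (𝓡 m) x) : Prop where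
  act_mem : ∀ u ∈ S, ∀ v ∈ S, ∀ a : GLm m, act u a ∈ S → act v a ∈ S
  dproj_eq : ∀ u ∈ S, dproj u (X u) = ξ (proj u)
  dact_eq : ∀ u ∈ S, ∀ a : GLm m, act u a ∈ S → X (act u a) = dact a u (X u)

/-- `projField` evaluates `Ξ` at one chosen frame; invariance makes the choice immaterial, as right
translations preserve the fibres. -/
theorem dproj_eq_projField {Ξ : ∀ u : LM m M, TangentSpace (JL m) u}
    (hΞ : IsInvariantVectorField Ξ) (u : LM m M) : dproj u (Ξ u) = projField Ξ (proj u) := by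
  obtain ⟨a, ha⟩ := exists_act u (frameAt (proj u)) rfl
  change dproj u (Ξ u) = dproj (frameAt (proj u)) (Ξ (frameAt (proj u)))
  rw [ha, ← hΞ.2 a u]
  exact (dproj_dact a u _).symm

theorem IsInvariantVectorField.isFieldOver {Ξ : ∀ u : LM m M, TangentSpace (JL m) u}
    (hΞ : IsInvariantVectorField Ξ) : IsFieldOver univ Ξ (projField Ξ) where
  act_mem _ _ _ _ _ _ := trivial
  dproj_eq u _ := dproj_eq_projField hΞ u
  dact_eq u _ a _ := (hΞ.2 a u).symm

/-- Locally `ξ = Tπ ∘ Ξ ∘ σ` for a smooth section `σ`. Class `C¹` is all that existence and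
uniqueness of integral curves on `M` require. -/
theorem contMDiff_projField {G : Subgroup (GLm m)} (P : GStructure m M G)
    {Ξ : ∀ u : LM m M, TangentSpace (JL m) u} (hΞ : IsInvariantVectorField Ξ) :
    ContMDiff (𝓡 m) (𝓡 m).tangent 1
      (fun x => (⟨x, projField Ξ x⟩ : TangentBundle (𝓡 m) M)) := by
  intro x
  obtain ⟨U, σ, hσ, hx, -⟩ := P.exists_localSection x
  have h1 : ContMDiff (JL m).tangent (𝓡 m).tangent 1 (tangentMap (JL m) (𝓡 m) (proj : LM m M → M)) :=
    contMDiff_proj.contMDiff_tangentMap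
      (WithTop.coe_le_coe.2 (le_top : (1 + 1 : ℕ∞) ≤ ⊤))
  have h2 : ContMDiffAt (𝓡 m) (JL m).tangent 1
      (fun y => (⟨σ y, Ξ (σ y)⟩ : TangentBundle (JL m) (LM m M))) x :=
    ContMDiffAt.comp x (hΞ.1.contMDiffAt.of_le (by exact_mod_cast le_top))
      ((hσ.contMDiffAt hx).of_le (by exact_mod_cast le_top))
  refine (h1.contMDiffAt.comp x h2).congr_of_eventuallyEq ?_
  filter_upwards [hσ.isOpen.mem_nhds hx] with y hy
  have h3 : (⟨proj (σ y), projField Ξ (proj (σ y))⟩ : TangentBundle (𝓡 m) M) =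
      tangentMap (JL m) (𝓡 m) proj ⟨σ y, Ξ (σ y)⟩ := by
    rw [← dproj_eq_projField hΞ]; rfl
  rw [hσ.proj_eq y hy] at h3
  exact h3

section Curves

variable {E : Type*} [NormedAddCommGroup E] [NormedSpace ℝ E] {H : Type*} [TopologicalSpace H]
  {I : ModelWithCorners ℝ E H} {N : Type*} [TopologicalSpace N] [ChartedSpace H N]

theorem IsMIntegralCurveOn.hasMFDerivAt_Ioo {γ : ℝ → N} {X : ∀ p : N, TangentSpace I p} {a b t : ℝ}
    (h : IsMIntegralCurveOn γ X (Ioo a b)) (ht : t ∈ Ioo a b) :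
    HasMFDerivAt 𝓘(ℝ, ℝ) I γ t ((1 : ℝ →L[ℝ] ℝ).smulRight (X (γ t))) :=
  (h t ht).hasMFDerivAt (isOpen_Ioo.mem_nhds ht)

theorem flowsTo_of_curve {S : Set N} {X : ∀ p : N, TangentSpace I p} {γ : ℝ → N} {a b : ℝ}
    (h : IsMIntegralCurveOn γ X (Ioo a b)) (hS : ∀ s ∈ Ioo a b, γ s ∈ S) {s t : ℝ}
    (hs : s ∈ Ioo a b) (ht : t ∈ Ioo a b) : FlowsTo I S X (t - s) (γ s) (γ t) := by
  have hset : {r | r + s ∈ Ioo a b} = Ioo (a - s) (b - s) := by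
    ext r
    simp only [mem_ofPred_eq, mem_Ioo]
    constructor <;> rintro ⟨h1, h2⟩ <;> constructor <;> linarith
  refine ⟨γ ∘ (· + s), a - s, b - s, ⟨by linarith [hs.1], by linarith [hs.2]⟩,
    ⟨by linarith [ht.1], by linarith [ht.2]⟩, ?_, ?_, by simp, by simp⟩
  · rw [← hset]
    exact h.comp_add s
  · intro r hr
    rw [← hset] at hr
    exact hS _ hr

theorem localFlow_eq {S : Set N} {X : ∀ p : N, TangentSpace I p} {t : ℝ} {p q : N}
    (huniq : ∀ {q'}, FlowsTo I S X t p q' → FlowsTo I S X t p q → q' = q)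
    (h : FlowsTo I S X t p q) : localFlow I S X t p = q := by
  rw [localFlow, dif_pos ⟨q, h⟩]
  exact huniq (Exists.choose_spec (⟨q, h⟩ : ∃ q, FlowsTo I S X t p q)) h

theorem FlowsTo.exists_common {S : Set N} {X : ∀ p : N, TangentSpace I p} {t : ℝ} {p q q' : N}
    (h : FlowsTo I S X t p q) (h' : FlowsTo I S X t p q') :
    ∃ (γ γ' : ℝ → N) (a b : ℝ), 0 ∈ Ioo a b ∧ t ∈ Ioo a b ∧ IsMIntegralCurveOn γ X (Ioo a b) ∧
      IsMIntegralCurveOn γ' X (Ioo a b) ∧ (∀ s ∈ Ioo a b, γ s ∈ S) ∧ (∀ s ∈ Ioo a b, γ' s ∈ S) ∧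
      γ 0 = γ' 0 ∧ γ t = q ∧ γ' t = q' := by
  obtain ⟨γ, a, b, h0, ht, hγ, hS, h1, h2⟩ := h
  obtain ⟨γ', a', b', h0', ht', hγ', hS', h1', h2'⟩ := h'
  have hsub : Ioo (max a a') (min b b') ⊆ Ioo a b :=
    Ioo_subset_Ioo (le_max_left _ _) (min_le_left _ _)
  have hsub' : Ioo (max a a') (min b b') ⊆ Ioo a' b' :=
    Ioo_subset_Ioo (le_max_right _ _) (min_le_right _ _)
  exact ⟨γ, γ', max a a', min b b', ⟨max_lt h0.1 h0'.1, lt_min h0.2 h0'.2⟩,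
    ⟨max_lt ht.1 ht'.1, lt_min ht.2 ht'.2⟩, hγ.mono hsub, hγ'.mono hsub', fun s hs => hS s (hsub hs),
    fun s hs => hS' s (hsub' hs), h1.trans h1'.symm, h2, h2'⟩

end Curves

theorem FlowsTo.unique_base [T2Space M] {ξ : ∀ x : M, TangentSpace (𝓡 m) x}
    (hξ : ContMDiff (𝓡 m) (𝓡 m).tangent 1 (fun x => (⟨x, ξ x⟩ : TangentBundle (𝓡 m) M)))
    {t : ℝ} {x y y' : M} (h : FlowsTo (𝓡 m) univ ξ t x y) (h' : FlowsTo (𝓡 m) univ ξ t x y') :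
    y = y' := by
  obtain ⟨γ, γ', a, b, h0, ht, hγ, hγ', -, -, h1, rfl, rfl⟩ := h.exists_common h'
  have : IsManifold (𝓡 m) 1 M := IsManifold.of_le (n := ∞) (by exact_mod_cast le_top)
  exact isMIntegralCurveOn_Ioo_eqOn_of_contMDiff_boundaryless h0 hξ hγ hγ' h1 ht

namespace IsFieldOver

variable {S : Set (LM m M)} {X : ∀ u : LM m M, TangentSpace (JL m) u}
  {ξ : ∀ x : M, TangentSpace (𝓡 m) x}

theorem proj_curve (hX : IsFieldOver S X ξ) {γ : ℝ → LM m M} {a b : ℝ}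
    (h : IsMIntegralCurveOn γ X (Ioo a b)) (hS : ∀ s ∈ Ioo a b, γ s ∈ S) :
    IsMIntegralCurveOn (fun s => proj (γ s)) ξ (Ioo a b) := by
  intro t ht
  have h1 := HasMFDerivAt.proj_curve (IsMIntegralCurveOn.hasMFDerivAt_Ioo h ht)
  rw [hX.dproj_eq _ (hS t ht)] at h1
  exact h1.hasMFDerivWithinAt

theorem act_flowsTo (hX : IsFieldOver S X ξ) {t : ℝ} {p q : LM m M} (h : FlowsTo (JL m) S X t p q)
    {c : GLm m} (hc : act p c ∈ S) : FlowsTo (JL m) S X t (act p c) (act q c) := by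
  obtain ⟨γ, a, b, h0, ht, hγ, hS, rfl, rfl⟩ := h
  have hcS : ∀ s ∈ Ioo a b, act (γ s) c ∈ S := fun s hs =>
    hX.act_mem _ (hS 0 h0) _ (hS s hs) c hc
  refine ⟨fun s => act (γ s) c, a, b, h0, ht, fun s hs => ?_, hcS, rfl, rfl⟩
  have h1 := HasMFDerivAt.act_curve (IsMIntegralCurveOn.hasMFDerivAt_Ioo hγ hs) c
  rw [← hX.dact_eq _ (hS s hs) c (hcS s hs)] at h1
  exact h1.hasMFDerivWithinAt

/-- Uniqueness without any regularity of `X`: two integral curves over the same base curve differ by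
a curve `g` in `GL(m, ℝ)`, and equivariance forces `g' = 0`. -/
theorem eqOn_of_proj_eqOn (hX : IsFieldOver S X ξ)
    (hsec : ∀ x : M, ∃ (U : Set M) (σ : M → LM m M), IsLocalSection U σ ∧ x ∈ U)
    {γ γ' : ℝ → LM m M} {a b : ℝ} (h0 : 0 ∈ Ioo a b)
    (h : IsMIntegralCurveOn γ X (Ioo a b)) (h' : IsMIntegralCurveOn γ' X (Ioo a b))
    (hS : ∀ s ∈ Ioo a b, γ s ∈ S) (hS' : ∀ s ∈ Ioo a b, γ' s ∈ S)
    (hp : ∀ s ∈ Ioo a b, proj (γ' s) = proj (γ s)) (h00 : γ 0 = γ' 0) : EqOn γ γ' (Ioo a b) := by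
  have hex : ∀ s, ∃ g : GLm m, s ∈ Ioo a b → γ' s = act (γ s) g := by
    intro s
    by_cases hs : s ∈ Ioo a b
    · obtain ⟨g, hg⟩ := exists_act (γ s) (γ' s) (hp s hs)
      exact ⟨g, fun _ => hg⟩
    · exact ⟨1, fun h => absurd h hs⟩
  choose g hg using hex
  have hder : ∀ t ∈ Ioo a b, HasDerivAt (fun s => (g s : Eu m →L[ℝ] Eu m)) 0 t := by
    intro t ht
    obtain ⟨U, σ, hσ, hU⟩ := hsec (proj (γ t))
    have hU' : proj (γ' t) ∈ U := by rwa [hp t ht]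
    have hmf := IsMIntegralCurveOn.hasMFDerivAt_Ioo h ht
    have h1 := hσ.hasDerivAt_coord_curve hmf hU
    have h2 := hσ.hasDerivAt_coord_curve (IsMIntegralCurveOn.hasMFDerivAt_Ioo h' ht) hU'
    have hXt : dcoord σ (γ' t) (X (γ' t)) = dcoord σ (γ t) (X (γ t)) * g t := by
      have hSt := hS' t ht
      rw [hg t ht] at hSt ⊢
      rw [hX.dact_eq _ (hS t ht) _ hSt]
      exact hσ.dcoord_dact hU _ _
    rw [hXt] at h2
    have hUn : ∀ᶠ s in 𝓝 t, proj (γ s) ∈ U :=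
      hmf.continuousAt.eventually (hσ.preimage_mem_nhds hU)
    have hco : ∀ᶠ s in 𝓝 t, (coord σ (γ' s) : Eu m →L[ℝ] Eu m) = coord σ (γ s) * g s := by
      filter_upwards [hUn, isOpen_Ioo.mem_nhds ht] with s hs hsI
      rw [hg s hsI, hσ.coord_act hs, Units.val_mul]
    -- `g` was obtained pointwise by choice; its differentiability comes from expressing it through
    -- the coordinates of the two curves.
    have hgd : DifferentiableAt ℝ (fun s => (g s : Eu m →L[ℝ] Eu m)) t := by
      have hinv : DifferentiableAt ℝ (fun s => Ring.inverse (coord σ (γ s) : Eu m →L[ℝ] Eu m)) t :=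
        DifferentiableAt.comp (g := Ring.inverse) t
          ((contDiffAt_ringInverse ℝ (n := 1) (coord σ (γ t))).differentiableAt one_ne_zero)
          h1.differentiableAt
      refine (hinv.clm_comp h2.differentiableAt).congr_of_eventuallyEq ?_
      filter_upwards [hco] with s hs
      change _ = Ring.inverse (coord σ (γ s) : Eu m →L[ℝ] Eu m) * (coord σ (γ' s) : Eu m →L[ℝ] Eu m)
      rw [hs, ← mul_assoc, Ring.inverse_mul_cancel _ (coord σ (γ s)).isUnit, one_mul]
    -- The product rule gives one more term, `coord · g'`, than equivariance does; so this term
    -- vanishes, and `coord` is invertible.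
    have h3 := (h1.mul hgd.hasDerivAt).congr_of_eventuallyEq hco
    have h4 := h2.unique h3
    have h5 : (coord σ (γ t) : Eu m →L[ℝ] Eu m) *
        deriv (fun s => (g s : Eu m →L[ℝ] Eu m)) t = 0 := by
      simpa using h4
    have h6 : deriv (fun s => (g s : Eu m →L[ℝ] Eu m)) t = 0 := (Units.mul_right_eq_zero _).1 h5
    rw [← h6]
    exact hgd.hasDerivAt
  intro t ht
  have hc := isOpen_Ioo.is_const_of_deriv_eq_zero isPreconnected_Ioo
    (fun s hs => (hder s hs).differentiableAt.differentiableWithinAt)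
    (fun s hs => (hder s hs).deriv) ht h0
  have hg0 : g 0 = 1 := by
    refine act_left_injective (γ 0) ?_
    rw [← hg 0 h0, act_one, h00]
  rw [hg t ht, Units.ext hc, hg0, act_one]

variable [T2Space M]

theorem flowsTo_unique (hX : IsFieldOver S X ξ)
    (hξ : ContMDiff (𝓡 m) (𝓡 m).tangent 1 (fun x => (⟨x, ξ x⟩ : TangentBundle (𝓡 m) M)))
    (hsec : ∀ x : M, ∃ (U : Set M) (σ : M → LM m M), IsLocalSection U σ ∧ x ∈ U)
    {t : ℝ} {p q q' : LM m M} (h : FlowsTo (JL m) S X t p q) (h' : FlowsTo (JL m) S X t p q') :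
    q = q' := by
  obtain ⟨γ, γ', a, b, h0, ht, hγ, hγ', hS, hS', h1, rfl, rfl⟩ := h.exists_common h'
  have : IsManifold (𝓡 m) 1 M := IsManifold.of_le (n := ∞) (by exact_mod_cast le_top)
  have hp := isMIntegralCurveOn_Ioo_eqOn_of_contMDiff_boundaryless h0 hξ (hX.proj_curve hγ hS)
    (hX.proj_curve hγ' hS') (congrArg proj h1)
  exact hX.eqOn_of_proj_eqOn hsec h0 hγ hγ' hS hS' (fun s hs => (hp hs).symm) h1 ht

/-- Translating integral curves by `a` and by `a⁻¹` shows that the flow is defined at `u` exactly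
when it is defined at `u · a`. Where it is not, the default value, the point itself, is equivariant
too. -/
theorem localFlow_act (hX : IsFieldOver S X ξ)
    (hξ : ContMDiff (𝓡 m) (𝓡 m).tangent 1 (fun x => (⟨x, ξ x⟩ : TangentBundle (𝓡 m) M)))
    (hsec : ∀ x : M, ∃ (U : Set M) (σ : M → LM m M), IsLocalSection U σ ∧ x ∈ U)
    (t : ℝ) {u : LM m M} (hu : u ∈ S) (a : GLm m) (ha : act u a ∈ S) :
    localFlow (JL m) S X t (act u a) = act (localFlow (JL m) S X t u) a := by
  by_cases h : ∃ q, FlowsTo (JL m) S X t u q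
  · obtain ⟨q, hq⟩ := h
    rw [localFlow_eq (hX.flowsTo_unique hξ hsec) hq,
      localFlow_eq (hX.flowsTo_unique hξ hsec) (hX.act_flowsTo hq ha)]
  · have h' : ¬ ∃ q, FlowsTo (JL m) S X t (act u a) q := by
      rintro ⟨q, hq⟩
      refine h ⟨act q a⁻¹, ?_⟩
      have h1 := hX.act_flowsTo hq (c := a⁻¹) (by rwa [act_act, mul_inv_cancel, act_one])
      rwa [act_act, mul_inv_cancel, act_one] at h1
    rw [localFlow, localFlow, dif_neg h, dif_neg h']

/-- The induced map of tensors along an integral curve. -/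
theorem inducedMap_curve (hX : IsFieldOver S X ξ)
    (hξ : ContMDiff (𝓡 m) (𝓡 m).tangent 1 (fun x => (⟨x, ξ x⟩ : TangentBundle (𝓡 m) M)))
    (hsec : ∀ x : M, ∃ (U : Set M) (σ : M → LM m M), IsLocalSection U σ ∧ x ∈ U)
    {γ : ℝ → LM m M} {a b : ℝ} (h : IsMIntegralCurveOn γ X (Ioo a b))
    (hS : ∀ s ∈ Ioo a b, γ s ∈ S) {s t : ℝ} (hs : s ∈ Ioo a b) (hst : s + t ∈ Ioo a b)
    (K : ∀ x : M, Tensors (TangentSpace (𝓡 m) x)) {f : Tensors (Eu m)}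
    (hf : assoc (γ (s + t)) f = ⟨proj (γ (s + t)), K (proj (γ (s + t)))⟩) :
    inducedMap S (localFlow (JL m) S X (-t)) ⟨localFlow (𝓡 m) univ ξ t (proj (γ s)),
      K (localFlow (𝓡 m) univ ξ t (proj (γ s)))⟩ = assoc (γ s) f := by
  have h1 : localFlow (𝓡 m) univ ξ t (proj (γ s)) = proj (γ (s + t)) := by
    refine localFlow_eq (FlowsTo.unique_base hξ) ?_
    have := flowsTo_of_curve (S := univ) (hX.proj_curve h hS) (fun _ _ => trivial) hs hst
    rwa [add_sub_cancel_left] at this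
  have h2 : localFlow (JL m) S X (-t) (γ (s + t)) = γ s := by
    refine localFlow_eq (hX.flowsTo_unique hξ hsec) ?_
    have := flowsTo_of_curve h hS hst hs
    rwa [sub_add_cancel_left] at this
  rw [h1, ← hf, inducedMap_assoc S _ (fun u hu a ha => hX.localFlow_act hξ hsec _ hu a ha) _
    (hS _ hst), h2]

/-- The derivative of the tensor field defined by `T` vanishes along a vector field with an integral
curve in `P`. -/
theorem hasDerivAlong_zero (hX : IsFieldOver S X ξ)
    (hξ : ContMDiff (𝓡 m) (𝓡 m).tangent 1 (fun x => (⟨x, ξ x⟩ : TangentBundle (𝓡 m) M)))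
    {T : Tensors (Eu m)} (P : GStructure m M (stabilizer T))
    {γ : ℝ → LM m M} {a b : ℝ} (h0 : 0 ∈ Ioo a b) (h : IsMIntegralCurveOn γ X (Ioo a b))
    (hS : ∀ s ∈ Ioo a b, γ s ∈ S) (hP : ∀ s ∈ Ioo a b, γ s ∈ P.carrier) :
    HasDerivAlong S X ξ (inducedTensorField P) (proj (γ 0)) 0 := by
  have hsec : ∀ x : M, ∃ (U : Set M) (σ : M → LM m M), IsLocalSection U σ ∧ x ∈ U := fun x =>
    let ⟨U, σ, hσ, hx, _⟩ := P.exists_localSection x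
    ⟨U, σ, hσ, hx⟩
  -- At time `t` the tensor `K` is `[γ t, T]`, and the flow carries it back to `[γ 0, T]`: the
  -- transported tensor does not depend on `t`.
  refine ⟨fun _ => inducedTensorField P (proj (γ 0)), ?_, fun rs α v => hasDerivAt_const _ _⟩
  filter_upwards [isOpen_Ioo.mem_nhds h0] with t ht
  have ht' : 0 + t ∈ Ioo a b := by rwa [zero_add]
  rw [hX.inducedMap_curve hξ hsec h hS h0 ht' _ ((mem_carrier_iff P _).1 (hP _ ht'))]
  exact (mem_carrier_iff P _).1 (hP 0 h0)

end IsFieldOver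

end Flows

/-! ### Infinitesimal generalized automorphisms and the Lie derivative -/

section LieDerivative

variable {m : ℕ} {M : Type*} [TopologicalSpace M] [ChartedSpace (Eu m) M] [IsManifold (𝓡 m) ∞ M]

theorem push_symm_push {V W : Type*} [AddCommGroup V] [Module ℝ V] [AddCommGroup W] [Module ℝ W]
    (e : V ≃ₗ[ℝ] W) (f : Tensors V) : push e.symm (push e f) = f := by
  rw [← push_trans, LinearEquiv.self_trans_symm, push_refl]

theorem push_push_symm {V W : Type*} [AddCommGroup V] [Module ℝ V] [AddCommGroup W] [Module ℝ W]
    (e : V ≃ₗ[ℝ] W) (f : Tensors W) : push e (push e.symm f) = f := by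
  rw [← push_trans, LinearEquiv.symm_trans_self, push_refl]

/-- The components of a pushed tensor are components of the original one, at transformed arguments.
-/
theorem HasTensorDerivAt.push {V W : Type*} [AddCommGroup V] [Module ℝ V] [AddCommGroup W]
    [Module ℝ W] (e : V ≃ₗ[ℝ] W) {f : ℝ → Tensors V} {L : Tensors V} {t : ℝ}
    (h : HasTensorDerivAt f L t) : HasTensorDerivAt (fun s => push e (f s)) (push e L) t :=
  fun rs α v => h rs (fun i => (α i).comp e.toLinearMap) (fun j => e.symm (v j))

theorem eq_of_hasTensorDerivAt_zero {V : Type*} [AddCommGroup V] [Module ℝ V] {f : ℝ → Tensors V}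
    {a b s t : ℝ} (h : ∀ r ∈ Ioo a b, HasTensorDerivAt f 0 r) (hs : s ∈ Ioo a b)
    (ht : t ∈ Ioo a b) : f s = f t := by
  refine DFinsupp.ext fun rs => MultilinearMap.ext fun α => MultilinearMap.ext fun v => ?_
  exact isOpen_Ioo.is_const_of_deriv_eq_zero (f := fun r => f r rs α v) isPreconnected_Ioo
    (fun r hr => (h r hr rs α v).differentiableAt.differentiableWithinAt)
    (fun r hr => (h r hr rs α v).deriv) hs ht

theorem isInfinitesimalGeneralizedAutomorphism_iff [T2Space M] {T : Tensors (Eu m)}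
    (P : GStructure m M (stabilizer T)) {Ξ : ∀ u : LM m M, TangentSpace (JL m) u}
    (hΞ : IsInvariantVectorField Ξ) : IsInfinitesimalGeneralizedAutomorphism P Ξ ↔
      ∀ x : M, HasLieDerivAt Ξ (inducedTensorField P) x 0 := by
  have hX := hΞ.isFieldOver
  have hξ := contMDiff_projField P hΞ
  constructor
  · intro h x
    obtain ⟨u, hu, rfl⟩ := P.exists_mem x
    have : IsManifold (JL m) 1 (LM m M) := inferInstance
    obtain ⟨γ, rfl, hγ⟩ := exists_isMIntegralCurveAt_of_contMDiffAt_boundaryless 0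
      (hΞ.1.contMDiffAt.of_le (by exact_mod_cast le_top) : ContMDiffAt _ _ 1 _ u)
    obtain ⟨ε, hε, hγ⟩ := isMIntegralCurveAt_iff'.1 hγ
    rw [Real.ball_eq_Ioo] at hγ
    have h0 : (0 : ℝ) ∈ Ioo (0 - ε) (0 + ε) := by constructor <;> linarith
    exact hX.hasDerivAlong_zero hξ P h0 hγ (fun _ _ => trivial)
      (fun s hs => h _ _ _ hu (flowsTo_of_curve (S := univ) hγ (fun _ _ => trivial) h0 hs))
  · rintro h t p q hp ⟨γ, a, b, h0, ht, hγ, -, rfl, rfl⟩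
    have hsec : ∀ x : M, ∃ (U : Set M) (σ : M → LM m M), IsLocalSection U σ ∧ x ∈ U := fun x =>
      let ⟨U, σ, hσ, hx, _⟩ := P.exists_localSection x
      ⟨U, σ, hσ, hx⟩
    -- `g s` is `K` read in the frame `γ s`. It is defined along the whole curve, before any frame
    -- other than `γ 0` is known to lie in `P`.
    set g : ℝ → Tensors (Eu m) := fun s =>
      push (γ s).toEquiv.symm (inducedTensorField P (proj (γ s))) with hg
    have hgs : ∀ s, assoc (γ s) (g s) = ⟨proj (γ s), inducedTensorField P (proj (γ s))⟩ :=
      fun s => Sigma.ext rfl (heq_of_eq (push_push_symm _ _))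
    have hder : ∀ s ∈ Ioo a b, HasTensorDerivAt g 0 s := by
      intro s hs
      obtain ⟨f, hf, hf'⟩ := h (proj (γ s))
      -- In the frame `γ s`, the transported tensor of the Lie derivative at `π (γ s)` is `g (s +
      -- r)`, so its derivative at `r = 0` is `g' s`.
      have hev : ∀ᶠ r in 𝓝 (0 : ℝ), g (s + r) = push (γ s).toEquiv.symm (f r) := by
        have hI : ∀ᶠ r in 𝓝 (0 : ℝ), s + r ∈ Ioo a b := by
          have : Tendsto (fun r : ℝ => s + r) (𝓝 0) (𝓝 s) := by
            simpa using (continuous_const_add s).tendsto (0 : ℝ)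
          exact this.eventually (isOpen_Ioo.mem_nhds hs)
        filter_upwards [hf, hI] with r hr hrI
        rw [hX.inducedMap_curve hξ hsec hγ (fun _ _ => trivial) hs hrI _ (hgs (s + r))] at hr
        have h1 : push (γ s).toEquiv (g (s + r)) = f r := eq_of_heq (Sigma.mk.inj hr).2
        rw [← h1, push_symm_push]
      intro rs α v
      have h1 := (hf'.push (γ s).toEquiv.symm rs α v).congr_of_eventuallyEq
        (f₁ := fun r => g (s + r) rs α v) (by
          filter_upwards [hev] with r hr
          rw [hr])
      rw [map_zero] at h1
      have h2 := HasDerivAt.comp_sub_const (f := fun r => g (s + r) rs α v) s s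
        (by rw [sub_self]; exact h1)
      simpa using h2
    have h1 := eq_of_hasTensorDerivAt_zero hder ht h0
    have h2 : g 0 = T := assoc_injective (γ 0) ((hgs 0).trans ((mem_carrier_iff P _).1 hp).symm)
    rw [mem_carrier_iff, ← hgs, h1, h2]

end LieDerivative

/-! ### Curves of matrices acting on a tensor -/

section TensorCurves

variable {m : ℕ}

/-- A multilinear function of differentiable families of vectors is differentiable. -/
theorem differentiableAt_multilinear {E F V : Type*} [NormedAddCommGroup E] [NormedSpace ℝ E]
    [AddCommGroup V] [Module ℝ V] [NormedAddCommGroup F] [NormedSpace ℝ F] {ι : Type*} [Fintype ι]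
    (b : Module.Basis ι ℝ V) {s : ℕ} (g : MultilinearMap ℝ (fun _ : Fin s => V) F)
    {w : E → Fin s → V} {e₀ : E} (hw : ∀ j k, DifferentiableAt ℝ (fun e => b.repr (w e j) k) e₀) :
    DifferentiableAt ℝ (fun e => g (w e)) e₀ := by
  classical
  have h : (fun e => g (w e)) = fun e => ∑ L : Fin s → ι,
      (∏ j, b.repr (w e j) (L j)) • g (fun j => b (L j)) := by
    funext e
    conv_lhs => rw [show w e = fun j => ∑ k, b.repr (w e j) k • b k from
      funext fun j => (b.sum_repr (w e j)).symm]
    rw [MultilinearMap.map_sum]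
    exact Finset.sum_congr rfl fun L _ => MultilinearMap.map_smul_univ _ _ _
  rw [h]
  refine DifferentiableAt.fun_sum fun L _ => DifferentiableAt.smul_const ?_ _
  exact (HasFDerivAt.finsetProd fun j _ => (hw j (L j)).hasFDerivAt).differentiableAt

/-- Expanding the covectors in the dual basis leaves products of scalar functions and multilinear
functions of the vectors alone, which the preceding lemma covers. -/
theorem differentiableAt_mixedTensor {E : Type*} [NormedAddCommGroup E] [NormedSpace ℝ E]
    {r s : ℕ} (T : MixedTensor (Eu m) r s) {β : E → Fin r → Module.Dual ℝ (Eu m)}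
    {w : E → Fin s → Eu m} {e₀ : E}
    (hβ : ∀ i x, DifferentiableAt ℝ (fun e => β e i x) e₀)
    (hw : ∀ j, DifferentiableAt ℝ (fun e => w e j) e₀) :
    DifferentiableAt ℝ (fun e => T (β e) (w e)) e₀ := by
  classical
  let b := (EuclideanSpace.basisFun (Fin m) ℝ).toBasis
  have hb : ∀ f : Module.Dual ℝ (Eu m), f = ∑ k, f (b k) • b.coord k :=
    fun f => (b.sum_dual_apply_smul_coord f).symm
  have h : (fun e => T (β e) (w e)) = fun e => ∑ L : Fin r → Fin m,
      (∏ i, β e i (b (L i))) * T (fun i => b.coord (L i)) (w e) := by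
    funext e
    conv_lhs => rw [show β e = fun i => ∑ k, β e i (b k) • b.coord k from
      funext fun i => hb (β e i)]
    rw [MultilinearMap.map_sum, sum_apply]
    refine Finset.sum_congr rfl fun L _ => ?_
    rw [MultilinearMap.map_smul_univ]
    rfl
  rw [h]
  refine DifferentiableAt.fun_sum fun L _ => DifferentiableAt.fun_mul ?_ ?_
  · exact (HasFDerivAt.finsetProd fun i _ => (hβ i (b (L i))).hasFDerivAt).differentiableAt
  · refine differentiableAt_multilinear b _ fun j k => ?_
    exact (LinearMap.toContinuousLinearMap (b.coord k)).differentiableAt.comp e₀ (hw j)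

theorem toEquiv_mul (a c : GLm m) : (a * c).toEquiv = c.toEquiv.trans a.toEquiv := rfl

theorem toEquiv_symm_apply (a : GLm m) (v : Eu m) :
    a.toEquiv.symm v = Ring.inverse (a : Eu m →L[ℝ] Eu m) v := by
  rw [Ring.inverse_unit]; rfl

/-- The tensor `a⁻¹ T`, as a function of the matrix `a`. -/
def pullMatrix (T : Tensors (Eu m)) (B : Eu m →L[ℝ] Eu m) : Tensors (Eu m) :=
  push (toGL B).toEquiv.symm T

/-- Near `B`, the components involve `C` only through `C` on vectors and `C⁻¹` on covectors, both
differentiable in `C`. -/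
theorem differentiableAt_pullMatrix (T : Tensors (Eu m)) (rs : ℕ × ℕ)
    (α : Fin rs.1 → Module.Dual ℝ (Eu m)) (v : Fin rs.2 → Eu m) {B : Eu m →L[ℝ] Eu m}
    (hB : IsUnit B) : DifferentiableAt ℝ (fun C => pullMatrix T C rs α v) B := by
  have h : DifferentiableAt ℝ (fun C : Eu m →L[ℝ] Eu m => T rs
      (fun i => (α i).comp (Ring.inverse C).toLinearMap) (fun j => C (v j))) B := by
    refine differentiableAt_mixedTensor _ (fun i x => ?_) fun j => ?_
    · have h1 : DifferentiableAt ℝ (Ring.inverse : (Eu m →L[ℝ] Eu m) → _) B := by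
        obtain ⟨a, rfl⟩ := hB
        exact (contDiffAt_ringInverse ℝ (n := 1) a).differentiableAt one_ne_zero
      exact (LinearMap.toContinuousLinearMap (α i)).differentiableAt.comp B
        (h1.clm_apply (differentiableAt_const x))
    · exact differentiableAt_id.clm_apply (differentiableAt_const _)
  refine h.congr_of_eventuallyEq ?_
  filter_upwards [eventually_isUnit hB] with C hC
  have h1 : ∀ x, (toGL C).toEquiv.symm x = Ring.inverse C x := fun x => by
    rw [toEquiv_symm_apply, toGL_val hC]
  have h2 : ∀ x, (toGL C).toEquiv x = C x := fun x =>
    congrArg (fun D : Eu m →L[ℝ] Eu m => D x) (toGL_val hC)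
  have h3 : (toGL C).toEquiv.symm.toLinearMap = (Ring.inverse C).toLinearMap := LinearMap.ext h1
  change pushMixed (toGL C).toEquiv.symm rs.1 rs.2 (T rs) α v = _
  rw [pushMixed_apply, h3, LinearEquiv.symm_symm]
  simp only [h2]

/-- The Lie algebra of the stabilizer of `T` annihilates `T`. -/
theorem fderiv_pullMatrix_one {T : Tensors (Eu m)} {A : Eu m →L[ℝ] Eu m}
    (hA : A ∈ lieAlg (stabilizer T)) (rs : ℕ × ℕ) (α : Fin rs.1 → Module.Dual ℝ (Eu m))
    (v : Fin rs.2 → Eu m) : fderiv ℝ (fun C => pullMatrix T C rs α v) 1 A = 0 := by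
  obtain ⟨c, -, hcG, hc1, hcA⟩ := hA
  have h1 : HasFDerivAt (fun C => pullMatrix T C rs α v)
      (fderiv ℝ (fun C => pullMatrix T C rs α v) 1) (c 0) := by
    rw [hc1]
    exact (differentiableAt_pullMatrix T rs α v isUnit_one).hasFDerivAt
  have h2 := h1.comp_hasDerivAt 0 hcA
  refine h2.unique ((hasDerivAt_const (0 : ℝ) (T rs α v)).congr_of_eventuallyEq ?_)
  -- Along a curve in the stabilizer, the pulled back tensor is constantly `T`.
  filter_upwards [hcG] with t ⟨g, hg, hgt⟩
  have h3 : push g.toEquiv.symm T = T := by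
    conv_lhs => rw [← show push g.toEquiv T = T from hg]
    exact push_symm_push _ _
  simp only [Function.comp_apply, pullMatrix]
  rw [← hgt, toGL_coe, h3]

/-- Write `a s = b s · u` with `u = a t` fixed. Then `b` passes through `1` with velocity `A`, so
`b⁻¹ T` has derivative zero, and `a⁻¹ T = u⁻¹ (b⁻¹ T)`. -/
theorem hasTensorDerivAt_pullMatrix {T : Tensors (Eu m)} {a : ℝ → Eu m →L[ℝ] Eu m}
    {A : Eu m →L[ℝ] Eu m} {t : ℝ} (hA : A ∈ lieAlg (stabilizer T)) (hu : IsUnit (a t))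
    (ha : HasDerivAt a (A * a t) t) : HasTensorDerivAt (fun s => pullMatrix T (a s)) 0 t := by
  obtain ⟨u, hut⟩ := hu
  set b : ℝ → Eu m →L[ℝ] Eu m := fun s => a s * (u⁻¹ : GLm m) with hb
  have hbt : b t = 1 := by simp [hb, ← hut]
  have hbd : HasDerivAt b A t := by
    have := ha.mul_const ((u⁻¹ : GLm m) : Eu m →L[ℝ] Eu m)
    rwa [← hut, mul_assoc, Units.mul_inv, mul_one] at this
  have hbD : HasTensorDerivAt (fun s => pullMatrix T (b s)) 0 t := by
    intro rs α v
    have h1 : HasFDerivAt (fun C => pullMatrix T C rs α v)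
        (fderiv ℝ (fun C => pullMatrix T C rs α v) 1) (b t) := by
      rw [hbt]
      exact (differentiableAt_pullMatrix T rs α v isUnit_one).hasFDerivAt
    have h2 := h1.comp_hasDerivAt t hbd
    rw [fderiv_pullMatrix_one hA] at h2
    exact h2
  have h3 := hbD.push (GLm.toEquiv u).symm
  rw [map_zero] at h3
  have hbu : ∀ᶠ s in 𝓝 t, IsUnit (b s) :=
    hbd.continuousAt.eventually (eventually_isUnit (by rw [hbt]; exact isUnit_one))
  intro rs α v
  refine (h3 rs α v).congr_of_eventuallyEq ?_
  filter_upwards [hbu] with s hs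
  have h4 : toGL (a s) = toGL (b s) * u := by
    refine Units.ext ?_
    have h5 : a s = b s * u := by simp [hb, mul_assoc]
    rw [Units.val_mul, toGL_val hs, toGL_val (by rw [h5]; exact hs.mul u.isUnit), h5]
  simp only [pullMatrix]
  rw [h4, toEquiv_mul, LinearEquiv.trans_symm, push_trans]

/-- A curve of matrices that starts in the stabilizer of `T` and is tangent to its Lie algebra stays
in the stabilizer. -/
theorem mem_stabilizer_of_hasDerivAt {T : Tensors (Eu m)} {a A : ℝ → Eu m →L[ℝ] Eu m}
    {ε : ℝ} (hA : ∀ t ∈ Ioo (-ε) ε, A t ∈ lieAlg (stabilizer T))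
    (hu : ∀ t ∈ Ioo (-ε) ε, IsUnit (a t)) (ha : ∀ t ∈ Ioo (-ε) ε, HasDerivAt a (A t * a t) t)
    (h0 : a 0 = 1) {t : ℝ} (ht : t ∈ Ioo (-ε) ε) : toGL (a t) ∈ stabilizer T := by
  have h0' : (0 : ℝ) ∈ Ioo (-ε) ε := by constructor <;> linarith [ht.1, ht.2]
  have h1 := eq_of_hasTensorDerivAt_zero
    (fun s hs => hasTensorDerivAt_pullMatrix (hA s hs) (hu s hs) (ha s hs)) ht h0'
  have h2 : pullMatrix T (a 0) = T := by
    have h3 : toGL (1 : Eu m →L[ℝ] Eu m) = 1 := toGL_coe 1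
    rw [h0, pullMatrix, h3]
    exact push_refl T
  rw [h2, pullMatrix] at h1
  change push (toGL (a t)).toEquiv T = T
  conv_lhs => rw [← h1]
  exact push_push_symm _ _

/-- A linear differential equation with continuous coefficients has local solutions. -/
theorem exists_linear_ode {R : Type*} [NormedRing R] [NormedAlgebra ℝ R] [CompleteSpace R]
    {A : ℝ → R} {δ : ℝ} (hδ : 0 < δ) (hA : ContinuousOn A (Icc (-δ) δ)) :
    ∃ ε > 0, ∃ a : ℝ → R, a 0 = 1 ∧ ∀ t ∈ Ioo (-ε) ε, HasDerivAt a (A t * a t) t := by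
  obtain ⟨C, hC⟩ := isCompact_Icc.exists_bound_of_continuousOn hA
  have hC0 : 0 ≤ C := (norm_nonneg _).trans (hC 0 ⟨by linarith, hδ.le⟩)
  lift C to NNReal using hC0
  -- On the unit ball about `1` one has `‖A t * x‖ ≤ C (‖1‖ + 1) = L`. With `ε ≤ 1 / (L + 1)`, a
  -- solution cannot leave this ball before time `ε`.
  set L : NNReal := C * (‖(1 : R)‖₊ + 1) with hL
  set ε : ℝ := min δ (1 / (L + 1)) with hε
  have hε0 : 0 < ε := lt_min hδ (by positivity)
  have hsub : Icc (-ε) ε ⊆ Icc (-δ) δ :=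
    Icc_subset_Icc (neg_le_neg (min_le_left _ _)) (min_le_left _ _)
  have hPL : IsPicardLindelof (fun t B => A t * B) (tmin := -ε) (tmax := ε)
      ⟨0, by constructor <;> linarith⟩ (1 : R) 1 0 L C := by
    refine ⟨fun t ht => ?_, fun x _ => (hA.mono hsub).mul continuousOn_const, fun t ht x hx => ?_, ?_⟩
    · refine LipschitzOnWith.of_dist_le_mul fun x _ y _ => ?_
      rw [dist_eq_norm, dist_eq_norm, ← mul_sub]
      exact (norm_mul_le _ _).trans (mul_le_mul_of_nonneg_right (hC t (hsub ht)) (norm_nonneg _))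
    · have hx1 : ‖x‖ ≤ ‖(1 : R)‖ + 1 := by
        have h1 : ‖x - 1‖ ≤ 1 := by simpa [dist_eq_norm] using hx
        have h2 : ‖x‖ ≤ ‖(1 : R)‖ + ‖x - 1‖ := by
          simpa using norm_add_le (1 : R) (x - 1)
        linarith
      refine (norm_mul_le _ _).trans ?_
      rw [hL]
      push_cast
      exact mul_le_mul (hC t (hsub ht)) hx1 (norm_nonneg _) C.2
    · have h1 : ε ≤ 1 / (L + 1) := min_le_right _ _
      have h2 : (L : ℝ) * ε ≤ L * (1 / (L + 1)) := mul_le_mul_of_nonneg_left h1 L.2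
      have h3 : (L : ℝ) * (1 / (L + 1)) ≤ 1 := by
        rw [mul_one_div, div_le_one (by positivity)]
        linarith
      simpa using h2.trans h3
  obtain ⟨a, ha0, ha⟩ := hPL.exists_eq_forall_mem_Icc_hasDerivWithinAt₀
  exact ⟨ε, hε0, a, ha0, fun t ht =>
    (ha t (Ioo_subset_Icc_self ht)).hasDerivAt (Icc_mem_nhds ht.1 ht.2)⟩

end TensorCurves

/-! ### The Kosmann vector field in coordinates -/

section Kosmann

variable {m : ℕ} {M : Type*} [TopologicalSpace M] [ChartedSpace (Eu m) M] [IsManifold (𝓡 m) ∞ M]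

/-! ### Fundamental vector fields -/

theorem hasMFDerivAt_val (a : GLm m) : HasMFDerivAt 𝓘(ℝ, Eu m →L[ℝ] Eu m)
    𝓘(ℝ, Eu m →L[ℝ] Eu m) (Units.val : GLm m → Eu m →L[ℝ] Eu m) a
    (ContinuousLinearMap.id ℝ (Eu m →L[ℝ] Eu m)) := by
  refine ⟨Units.continuous_val.continuousAt, ?_⟩
  refine HasFDerivAt.hasFDerivWithinAt ((hasFDerivAt_id _).congr_of_eventuallyEq ?_)
  have hB : range (Units.val : GLm m → _) ∈ 𝓝 (a : Eu m →L[ℝ] Eu m) :=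
    Units.isOpenEmbedding_val.isOpen_range.mem_nhds ⟨a, rfl⟩
  filter_upwards [hB] with C hC
  obtain ⟨b, rfl⟩ := hC
  exact congrArg Units.val (Topology.IsOpenEmbedding.toOpenPartialHomeomorph_left_inv
    (h := Units.isOpenEmbedding_val (R := Eu m →L[ℝ] Eu m)))

/-- The value at `u` of the fundamental vector field of `C`. -/
def fundamental (u : LM m M) (C : Eu m →L[ℝ] Eu m) : TangentSpace (JL m) u :=
  mfderiv 𝓘(ℝ, Eu m →L[ℝ] Eu m) (JL m) (fun a : GLm m => act u a) 1 C

theorem mem_transverse_iff {𝔪 : Submodule ℝ (Eu m →L[ℝ] Eu m)} {u : LM m M}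
    {v : TangentSpace (JL m) u} : v ∈ transverse 𝔪 u ↔ ∃ C ∈ 𝔪, fundamental u C = v := by
  have h : ∀ C, (⟨u, fundamental u C⟩ : TangentBundle (JL m) (LM m M)) = ⟨u, v⟩ ↔
      fundamental u C = v := fun C => Bundle.TotalSpace.mk_inj ..
  exact ⟨fun ⟨C, hC, hv⟩ => ⟨C, hC, (h C).1 hv⟩, fun ⟨C, hC, hv⟩ => ⟨C, hC, (h C).2 hv⟩⟩

theorem hasMFDerivAt_act_one (u : LM m M) : HasMFDerivAt 𝓘(ℝ, Eu m →L[ℝ] Eu m) (JL m)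
    (fun a : GLm m => act u a) 1
      (mfderiv 𝓘(ℝ, Eu m →L[ℝ] Eu m) (JL m) (fun a : GLm m => act u a) 1) :=
  ((contMDiff_act_left u).mdifferentiableAt (by simp)).hasMFDerivAt

theorem dproj_fundamental (u : LM m M) (C : Eu m →L[ℝ] Eu m) : dproj u (fundamental u C) = 0 := by
  have h := (hasMFDerivAt_proj u).comp (1 : GLm m) (hasMFDerivAt_act_one u)
  have h1 : HasMFDerivAt 𝓘(ℝ, Eu m →L[ℝ] Eu m) (𝓡 m) (proj ∘ fun a : GLm m => act u a) 1 0 :=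
    hasMFDerivAt_const (proj u) (1 : GLm m)
  exact congrArg (fun f => f C) (hasMFDerivAt_unique h h1)

namespace IsLocalSection

variable {U : Set M} {σ : M → LM m M} (hσ : IsLocalSection U σ)
include hσ

theorem dcoord_fundamental {u : LM m M} (hu : proj u ∈ U) (C : Eu m →L[ℝ] Eu m) :
    dcoord σ u (fundamental u C) = coord σ u * C := by
  have h := HasMFDerivAt.comp (1 : GLm m) (hσ.hasMFDerivAt_coord hu) (hasMFDerivAt_act_one u)
  have h1 : HasMFDerivAt 𝓘(ℝ, Eu m →L[ℝ] Eu m) 𝓘(ℝ, Eu m →L[ℝ] Eu m)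
      (fun B : Eu m →L[ℝ] Eu m => (coord σ u : Eu m →L[ℝ] Eu m) * B) ((1 : GLm m) : Eu m →L[ℝ] Eu m)
      (ContinuousLinearMap.compL ℝ (Eu m) (Eu m) (Eu m) (coord σ u : Eu m →L[ℝ] Eu m)) :=
    (ContinuousLinearMap.compL ℝ (Eu m) (Eu m) (Eu m)
      (coord σ u : Eu m →L[ℝ] Eu m)).hasFDerivAt.hasMFDerivAt
  have h2 := (h1.comp (1 : GLm m) (hasMFDerivAt_val 1)).congr_of_eventuallyEq
    (f₁ := (fun v : LM m M => (coord σ v : Eu m →L[ℝ] Eu m)) ∘ fun a => act u a) (by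
      refine Eventually.of_forall fun a => ?_
      simp [hσ.coord_act hu])
  exact congrArg (fun f => f C) (hasMFDerivAt_unique h h2)

/-- An invariant vector field in coordinates. -/
theorem dcoord_invariant {Ξ : ∀ u : LM m M, TangentSpace (JL m) u} (hΞ : IsInvariantVectorField Ξ)
    {u : LM m M} (hu : proj u ∈ U) :
    dcoord σ u (Ξ u) = dcoord σ (σ (proj u)) (Ξ (σ (proj u))) * coord σ u := by
  have h1 : proj (σ (proj u)) ∈ U := by rwa [hσ.proj_eq _ hu]
  have h2 := hσ.dcoord_dact h1 (coord σ u) (Ξ (σ (proj u)))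
  rw [show dact (coord σ u) (σ (proj u)) (Ξ (σ (proj u))) = _ from hΞ.2 _ _, hσ.act_coord hu] at h2
  exact h2

/-- This is the continuity in `y` of the matrix part of `Ξ` along the section; it provides
continuous coefficients for the linear equation of the integral curves. -/
theorem continuousOn_dcoord {Ξ : ∀ u : LM m M, TangentSpace (JL m) u}
    (hΞ : IsInvariantVectorField Ξ) :
    ContinuousOn (fun y => dcoord σ (σ y) (Ξ (σ y))) U := by
  have hV : IsOpen (proj ⁻¹' U : Set (LM m M)) := hσ.isOpen.preimage contMDiff_proj.continuous
  have h1 : ContMDiffOn (JL m) 𝓘(ℝ, Eu m →L[ℝ] Eu m) ∞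
      (fun v : LM m M => (coord σ v : Eu m →L[ℝ] Eu m)) (proj ⁻¹' U) :=
    fun u hu => (hσ.contMDiffAt_coord hu).contMDiffWithinAt
  have h2 := h1.continuousOn_tangentMapWithin (by simp) hV.uniqueMDiffOn
  have h3 : ContinuousOn (fun y => (⟨σ y, Ξ (σ y)⟩ : TangentBundle (JL m) (LM m M))) U :=
    hΞ.1.continuous.comp_continuousOn hσ.contMDiffOn.continuousOn
  have hmem : ∀ y ∈ U, proj (σ y) ∈ U := fun y hy => by rwa [hσ.proj_eq y hy]
  have h4 := (contMDiff_snd_tangentBundle_modelSpace (n := 0) (Eu m →L[ℝ] Eu m)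
    𝓘(ℝ, Eu m →L[ℝ] Eu m)).continuous.comp_continuousOn (h2.comp h3 hmem)
  refine h4.congr fun y hy => ?_
  have h5 : mfderivWithin (JL m) 𝓘(ℝ, Eu m →L[ℝ] Eu m)
      (fun v : LM m M => (coord σ v : Eu m →L[ℝ] Eu m)) (proj ⁻¹' U) (σ y) = dcoord σ (σ y) :=
    mfderivWithin_of_isOpen hV (hmem y hy)
  exact congrArg (fun f => f (Ξ (σ y))) h5.symm

end IsLocalSection

/-! ### The tangent spaces of a `G`-structure -/

/-- A straight line in the preferred chart at `x` works: the tangent space at `x` is identified with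
`ℝᵐ` by this very chart, so its inverse has the identity as differential there. -/
theorem exists_curve_of_velocity (x : M) (w : Eu m) :
    ∃ y : ℝ → M, y 0 = x ∧ ContMDiffAt 𝓘(ℝ, ℝ) (𝓡 m) ∞ y 0 ∧
      HasMFDerivAt 𝓘(ℝ, ℝ) (𝓡 m) y 0 ((1 : ℝ →L[ℝ] ℝ).smulRight w) := by
  have : IsManifold (𝓡 m) 1 M := IsManifold.of_le (n := ∞) (by exact_mod_cast le_top)
  set z := extChartAt (𝓡 m) x x with hz
  let l : ℝ → Eu m := fun t => z + t • w
  have hl0 : l 0 = z := by simp [l]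
  have hl : HasDerivAt l w 0 :=
    (((hasDerivAt_id (0 : ℝ)).smul_const w).const_add z).congr_deriv (one_smul ℝ w)
  have hls : ContDiff ℝ ∞ l := contDiff_const.add (contDiff_id.smul contDiff_const)
  have hs : ContMDiffAt 𝓘(ℝ, Eu m) (𝓡 m) ∞ (extChartAt (𝓡 m) x).symm z :=
    (contMDiffOn_extChartAt_symm x).contMDiffAt (extChartAt_target_mem_nhds x)
  have hd : HasMFDerivAt 𝓘(ℝ, Eu m) (𝓡 m) (extChartAt (𝓡 m) x).symm z
      (ContinuousLinearMap.id ℝ (Eu m)) := by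
    have h1 := mfderivWithin_range_extChartAt_symm (I := 𝓡 m) (x := x)
    have h2 := (hs.mdifferentiableAt (by simp)).hasMFDerivAt
    have h3 : range (𝓡 m) = univ := ModelWithCorners.range_eq_univ _
    rw [h3, mfderivWithin_univ] at h1
    rw [← hz] at h1
    rw [h1] at h2
    exact h2
  refine ⟨fun t => (extChartAt (𝓡 m) x).symm (l t), ?_, ?_, ?_⟩
  · simp only [hl0, hz]
    exact extChartAt_to_inv x
  · rw [← hl0] at hs
    exact hs.comp 0 hls.contMDiff.contMDiffAt
  · rw [← hl0] at hd
    exact hd.comp 0 hl.hasFDerivAt.hasMFDerivAt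

namespace GStructure

variable {G : Subgroup (GLm m)} (P : GStructure m M G) {U : Set M} {σ : M → LM m M}

theorem coord_mem (hσ : IsLocalSection U σ) (hP : ∀ y ∈ U, σ y ∈ P.carrier) {u : LM m M}
    (hu : proj u ∈ U) (huP : u ∈ P.carrier) : coord σ u ∈ G := by
  rw [← P.act_mem_iff (hP _ hu), hσ.act_coord hu]
  exact huP

/-- A curve in `P` has its matrix coordinate in `G`; right multiplication by the inverse of the
initial value makes it a curve in `G` through `1`. -/
theorem dcoord_mem_lieAlg (hσ : IsLocalSection U σ) (hP : ∀ y ∈ U, σ y ∈ P.carrier) {u : LM m M}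
    (hu : proj u ∈ U) {w : TangentSpace (JL m) u} (hw : w ∈ tangentTo P u) :
    dcoord σ u w * ((coord σ u)⁻¹ : GLm m) ∈ lieAlg G := by
  obtain ⟨c, hc, hcP, hcw⟩ := hw
  have hc0 : c 0 = u := congrArg Bundle.TotalSpace.proj hcw
  subst hc0
  have hw : mfderiv 𝓘(ℝ, ℝ) (JL m) c 0 (1 : ℝ) = w := Bundle.TotalSpace.mk_inj.1 hcw
  have hcd : HasMFDerivAt 𝓘(ℝ, ℝ) (JL m) c 0 ((1 : ℝ →L[ℝ] ℝ).smulRight w) := by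
    rw [← hw]
    exact (hc.mdifferentiableAt (by simp)).hasMFDerivAt.congr_mfderiv (eq_smulRight_one _)
  have hUn : ∀ᶠ s in 𝓝 (0 : ℝ), proj (c s) ∈ U :=
    hc.continuousAt.eventually (hσ.preimage_mem_nhds hu)
  refine ⟨fun s => coord σ (c s) * ((coord σ (c 0))⁻¹ : GLm m), ?_, ?_, ?_, ?_⟩
  · have h1 := ((hσ.contMDiffAt_coord hu).comp (0 : ℝ) hc).contDiffAt
    exact h1.mul contDiffAt_const
  · filter_upwards [hUn, hcP] with s hs hsP
    exact ⟨_, G.mul_mem (P.coord_mem hσ hP hs hsP) (G.inv_mem (P.coord_mem hσ hP hu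
      hcP.self_of_nhds)), rfl⟩
  · exact Units.mul_inv _
  · exact (hσ.hasDerivAt_coord_curve hcd hu).mul_const _

/-- Combine a base curve of velocity `dproj u w` with a curve `c` in `G` of velocity `A`: the frames
`σ(y s) · c s · coord σ u` lie in `P` and have velocity `w`. -/
theorem mem_tangentTo (hσ : IsLocalSection U σ) (hP : ∀ y ∈ U, σ y ∈ P.carrier) {u : LM m M}
    (hu : proj u ∈ U) (huP : u ∈ P.carrier) {w : TangentSpace (JL m) u} {A : Eu m →L[ℝ] Eu m}
    (hA : A ∈ lieAlg G) (hw : dcoord σ u w = A * coord σ u) : w ∈ tangentTo P u := by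
  obtain ⟨c, hc, hcG, hc1, hcA⟩ := hA
  obtain ⟨y, hy0, hys, hyd⟩ := exists_curve_of_velocity (proj u) (dproj u w)
  set B : ℝ → Eu m →L[ℝ] Eu m := fun s => c s * coord σ u with hB
  have hB0 : B 0 = coord σ u := by simp [hB, hc1]
  have hBs : ContDiffAt ℝ ∞ B 0 := hc.mul contDiffAt_const
  have hBd : HasDerivAt B (dcoord σ u w) 0 := by
    rw [hw]
    exact hcA.mul_const _
  have hyU : y 0 ∈ U := by rwa [hy0]
  have hBu : IsUnit (B 0) := by rw [hB0]; exact (coord σ u).isUnit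
  have hu0 : act (σ (y 0)) (toGL (B 0)) = u := by
    rw [hy0, hB0, toGL_coe, hσ.act_coord hu]
  refine ⟨fun s => act (σ (y s)) (toGL (B s)), ?_, ?_,
    hσ.tangentMap_frame_curve hyU hBu hu0 hyd hBd⟩
  · exact ContMDiffAt.comp (f := fun s => (y s, B s)) (0 : ℝ) (hσ.contMDiffAt_frame hyU hBu)
      (hys.prodMk hBs.contMDiffAt)
  · filter_upwards [hys.continuousAt.eventually (hσ.isOpen.mem_nhds hyU), hcG] with s hs ⟨g, hg, hgs⟩
    have h1 : toGL (B s) = g * coord σ u := by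
      rw [← toGL_coe (g * coord σ u), Units.val_mul, hgs]
    rw [h1]
    exact P.act_mem _ (hP _ hs) _ (G.mul_mem hg (P.coord_mem hσ hP hu huP))

/-- The generalized Kosmann vector field in coordinates. -/
theorem kosmann_spec (hσ : IsLocalSection U σ) (hP : ∀ y ∈ U, σ y ∈ P.carrier)
    {𝔪 : Submodule ℝ (Eu m →L[ℝ] Eu m)} (h𝔪 : IsReductiveComplement G 𝔪)
    {Ξ : ∀ u : LM m M, TangentSpace (JL m) u} (hΞ : IsInvariantVectorField Ξ) {u : LM m M}
    (hu : proj u ∈ U) (huP : u ∈ P.carrier) :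
    dproj u (kosmann P 𝔪 Ξ u) = projField Ξ (proj u) ∧ dcoord σ u (kosmann P 𝔪 Ξ u) =
      (lieAlg G).projection 𝔪 h𝔪.1 (dcoord σ (σ (proj u)) (Ξ (σ (proj u)))) * coord σ u := by
  set Θ := dcoord σ (σ (proj u)) (Ξ (σ (proj u))) with hΘ
  set pr := (lieAlg G).projection 𝔪 h𝔪.1 with hpr
  have hg : coord σ u ∈ G := P.coord_mem hσ hP hu huP
  have hΞu : dcoord σ u (Ξ u) = Θ * coord σ u := hσ.dcoord_invariant hΞ hu
  have hex : ∃ v : TangentSpace (JL m) u, v ∈ tangentTo P u ∧ Ξ u - v ∈ transverse 𝔪 u := by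
    -- The fundamental field of `C` has matrix part `coord σ u * C`. This choice makes it `(Θ - pr
    -- Θ) * coord σ u`, and `C ∈ 𝔪` by `Ad`-invariance.
    set C : Eu m →L[ℝ] Eu m := ((coord σ u)⁻¹ : GLm m) * (Θ - pr Θ) * coord σ u with hC
    have hCm : C ∈ 𝔪 := by
      have := h𝔪.2 _ (G.inv_mem hg) _ (Submodule.sub_projection_mem h𝔪.1 Θ)
      rwa [inv_inv] at this
    refine ⟨Ξ u - fundamental u C, ?_, mem_transverse_iff.2 ⟨C, hCm, by abel⟩⟩
    refine P.mem_tangentTo hσ hP hu huP (Submodule.projection_apply_mem h𝔪.1 Θ) ?_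
    rw [map_sub, hΞu, hσ.dcoord_fundamental hu, hC, mul_assoc, Units.mul_inv_cancel_left, sub_mul]
    abel
  have hk : kosmann P 𝔪 Ξ u = hex.choose := dif_pos hex
  obtain ⟨h1, h2⟩ := hex.choose_spec
  rw [hk]
  generalize hex.choose = v at h1 h2
  obtain ⟨C, hC, hCv⟩ := mem_transverse_iff.1 h2
  constructor
  · have h3 := dproj_fundamental u C
    rw [hCv, map_sub, sub_eq_zero, dproj_eq_projField hΞ] at h3
    exact h3.symm
  · have h3 := hσ.dcoord_fundamental hu C
    rw [hCv, map_sub, hΞu] at h3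
    -- This argument holds for any admissible `v`, hence for the chosen one: `Θ` splits into a term
    -- of `𝔤` and the conjugate of `C` in `𝔪`, which determines both.
    have h4 : dcoord σ u v = (Θ - coord σ u * C * ((coord σ u)⁻¹ : GLm m)) * coord σ u := by
      rw [sub_mul, Units.inv_mul_cancel_right, ← h3]
      abel
    have h5 := P.dcoord_mem_lieAlg hσ hP hu h1
    rw [h4, Units.mul_inv_cancel_right] at h5
    have h6 : pr Θ = Θ - coord σ u * C * ((coord σ u)⁻¹ : GLm m) := by
      have h7 := Submodule.projection_apply_left h𝔪.1 ⟨_, h5⟩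
      have h8 := Submodule.projection_apply_right h𝔪.1 ⟨_, h𝔪.2 _ hg C hC⟩
      have h9 : Θ = (Θ - coord σ u * C * ((coord σ u)⁻¹ : GLm m)) +
        coord σ u * C * ((coord σ u)⁻¹ : GLm m) := by abel
      conv_lhs => rw [h9, map_add]
      exact (congrArg₂ (· + ·) h7 h8).trans (add_zero _)
    rw [h4, h6]

/-- In coordinates the field has matrix part `pr Θ · coord σ u` with `Θ` depending only on the base
point; translation by `a` multiplies it by `a` on the right. -/
theorem isFieldOver_kosmann {𝔪 : Submodule ℝ (Eu m →L[ℝ] Eu m)} (h𝔪 : IsReductiveComplement G 𝔪)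
    {Ξ : ∀ u : LM m M, TangentSpace (JL m) u} (hΞ : IsInvariantVectorField Ξ) :
    IsFieldOver P.carrier (kosmann P 𝔪 Ξ) (projField Ξ) where
  act_mem u hu v hv a ha := P.act_mem v hv a ((P.act_mem_iff hu).1 ha)
  dproj_eq u hu := by
    obtain ⟨U, σ, hσ, hU, hP⟩ := P.exists_localSection (proj u)
    exact (P.kosmann_spec hσ hP h𝔪 hΞ hU hu).1
  dact_eq u hu a ha := by
    obtain ⟨U, σ, hσ, hU, hP⟩ := P.exists_localSection (proj u)
    have h1 := P.kosmann_spec hσ hP h𝔪 hΞ hU hu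
    have h2 := P.kosmann_spec hσ hP h𝔪 hΞ (u := act u a) hU ha
    refine hσ.ext_vector (u := act u a) hU ?_ ?_
    · exact h2.1.trans (h1.1.symm.trans (dproj_dact a u _).symm)
    · refine h2.2.trans (Eq.trans ?_ (hσ.dcoord_dact hU a _).symm)
      rw [h1.2, hσ.coord_act hU, Units.val_mul, mul_assoc]
      rfl

end GStructure

end Kosmann

/-! ### Integral curves in `P` and the reductive Lie derivative -/

section ReductiveLieDerivative

variable {m : ℕ} {M : Type*} [TopologicalSpace M] [ChartedSpace (Eu m) M] [IsManifold (𝓡 m) ∞ M]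

/-- The generalized Kosmann vector field has integral curves in `P`. -/
theorem exists_integralCurve_kosmann {T : Tensors (Eu m)} (P : GStructure m M (stabilizer T))
    {𝔪 : Submodule ℝ (Eu m →L[ℝ] Eu m)} (h𝔪 : IsReductiveComplement (stabilizer T) 𝔪)
    {Ξ : ∀ u : LM m M, TangentSpace (JL m) u} (hΞ : IsInvariantVectorField Ξ) (x : M) :
    ∃ ε > 0, ∃ γ : ℝ → LM m M, proj (γ 0) = x ∧
      IsMIntegralCurveOn γ (kosmann P 𝔪 Ξ) (Ioo (-ε) ε) ∧ ∀ t ∈ Ioo (-ε) ε, γ t ∈ P.carrier := by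
  obtain ⟨U, σ, hσ, hx, hP⟩ := P.exists_localSection x
  have : IsManifold (𝓡 m) 1 M := IsManifold.of_le (n := ∞) (by exact_mod_cast le_top)
  obtain ⟨y, hy0, hy⟩ := exists_isMIntegralCurveAt_of_contMDiffAt_boundaryless (x₀ := x) 0
    (contMDiff_projField P hΞ).contMDiffAt
  have hyU : ∀ᶠ t in 𝓝 (0 : ℝ), y t ∈ U :=
    hy.continuousAt.eventually (hσ.isOpen.mem_nhds (by rwa [hy0]))
  obtain ⟨δ, hδ, hδy⟩ := Metric.eventually_nhds_iff_ball.1 (hyU.and hy)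
  rw [Real.ball_eq_Ioo, zero_sub, zero_add] at hδy
  -- By `kosmann_spec`, `σ(y t) · a t` is an integral curve as long as it stays in `P` and `a' = A
  -- a`, with `A` the `𝔤`-part of `Ξ` along `σ ∘ y`.
  set A : ℝ → Eu m →L[ℝ] Eu m := fun t => (lieAlg (stabilizer T)).projection 𝔪 h𝔪.1
    (dcoord σ (σ (y t)) (Ξ (σ (y t)))) with hA
  have hsub : Icc (-(δ / 2)) (δ / 2) ⊆ Ioo (-δ) δ := fun t ht =>
    ⟨by linarith [ht.1], by linarith [ht.2]⟩
  have hAc : ContinuousOn A (Icc (-(δ / 2)) (δ / 2)) := by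
    have h1 : ContinuousOn y (Icc (-(δ / 2)) (δ / 2)) := fun t ht =>
      (hδy t (hsub ht)).2.continuousAt.continuousWithinAt
    exact ((lieAlg (stabilizer T)).projection 𝔪 h𝔪.1).continuous_of_finiteDimensional.comp_continuousOn
      ((hσ.continuousOn_dcoord hΞ).comp h1 fun t ht => (hδy t (hsub ht)).1)
  obtain ⟨ε₁, hε₁, a, ha0, ha⟩ := exists_linear_ode (half_pos hδ) hAc
  have hau : ∀ᶠ t in 𝓝 (0 : ℝ), IsUnit (a t) :=
    (ha 0 ⟨by linarith, hε₁⟩).continuousAt.eventually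
      (eventually_isUnit (by rw [ha0]; exact isUnit_one))
  obtain ⟨ε₂, hε₂, hau⟩ := Metric.eventually_nhds_iff_ball.1 hau
  rw [Real.ball_eq_Ioo, zero_sub, zero_add] at hau
  set ε := min δ (min ε₁ ε₂) with hε
  have hεδ : Ioo (-ε) ε ⊆ Ioo (-δ) δ :=
    Ioo_subset_Ioo (neg_le_neg (min_le_left _ _)) (min_le_left _ _)
  have hle1 : ε ≤ ε₁ := (min_le_right _ _).trans (min_le_left _ _)
  have hle2 : ε ≤ ε₂ := (min_le_right _ _).trans (min_le_right _ _)
  have hε1 : Ioo (-ε) ε ⊆ Ioo (-ε₁) ε₁ := Ioo_subset_Ioo (neg_le_neg hle1) hle1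
  have hε2 : Ioo (-ε) ε ⊆ Ioo (-ε₂) ε₂ := Ioo_subset_Ioo (neg_le_neg hle2) hle2
  set γ : ℝ → LM m M := fun t => act (σ (y t)) (toGL (a t)) with hγ
  have hγP : ∀ t ∈ Ioo (-ε) ε, γ t ∈ P.carrier := fun t ht =>
    -- Membership in `P` comes first, since the coordinate formula for the Kosmann field is
    -- available only at frames of `P`.
    P.act_mem _ (hP _ (hδy t (hεδ ht)).1) _ (mem_stabilizer_of_hasDerivAt
      (A := A) (fun s _ => Submodule.projection_apply_mem h𝔪.1 _) (fun s hs => hau s (hε2 hs))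
      (fun s hs => ha s (hε1 hs)) ha0 ht)
  refine ⟨ε, lt_min hδ (lt_min hε₁ hε₂), γ, ?_, fun t ht => ?_, hγP⟩
  · rw [← hy0]
    exact hσ.proj_eq _ (by rwa [hy0])
  · have htU := (hδy t (hεδ ht)).1
    have htu := hau t (hε2 ht)
    have hp : proj (γ t) = y t := hσ.proj_eq _ htU
    have hpU : proj (γ t) ∈ U := by rwa [hp]
    have hc : (coord σ (γ t) : Eu m →L[ℝ] Eu m) = a t := by
      rw [hγ, hσ.coord_eq htU, toGL_val htu]
    obtain ⟨h1, h2⟩ := P.kosmann_spec hσ hP h𝔪 hΞ hpU (hγP t ht)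
    refine (hσ.hasMFDerivAt_frame_curve htU htu (v := kosmann P 𝔪 Ξ (γ t)) ?_ ?_).hasMFDerivWithinAt
    · have h3 : (dproj (γ t) (kosmann P 𝔪 Ξ (γ t)) : Eu m) = projField Ξ (y t) := by
        rw [← hp]; exact h1
      exact (hδy t (hεδ ht)).2.congr_mfderiv
        (congrArg (fun w : Eu m => (1 : ℝ →L[ℝ] ℝ).smulRight w) h3.symm)
    · refine (ha t (hε1 ht)).congr_deriv (Eq.symm (h2.trans ?_))
      rw [hc, hp]

theorem hasReductiveLieDerivAt_zero [T2Space M] {T : Tensors (Eu m)}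
    (P : GStructure m M (stabilizer T)) {𝔪 : Submodule ℝ (Eu m →L[ℝ] Eu m)}
    (h𝔪 : IsReductiveComplement (stabilizer T) 𝔪) {Ξ : ∀ u : LM m M, TangentSpace (JL m) u}
    (hΞ : IsInvariantVectorField Ξ) (x : M) :
    HasReductiveLieDerivAt P 𝔪 Ξ (inducedTensorField P) x 0 := by
  obtain ⟨ε, hε, γ, rfl, hγ, hP⟩ := exists_integralCurve_kosmann P h𝔪 hΞ x
  exact (P.isFieldOver_kosmann h𝔪 hΞ).hasDerivAlong_zero (contMDiff_projField P hΞ) P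
    ⟨neg_lt_zero.2 hε, hε⟩ hγ hP hP

end ReductiveLieDerivative

end GStr

end

theorem mainTheorem5 {m : ℕ} {M : Type*} [TopologicalSpace M] [T2Space M]
    [ChartedSpace (EuclideanSpace ℝ (Fin m)) M] [IsManifold (𝓡 m) ∞ M]
    (T : GStr.Tensors (EuclideanSpace ℝ (Fin m)))
    (𝔪 : Submodule ℝ (EuclideanSpace ℝ (Fin m) →L[ℝ] EuclideanSpace ℝ (Fin m)))
    (h𝔪 : GStr.IsReductiveComplement (GStr.stabilizer T) 𝔪)
    (P : GStr.GStructure m M (GStr.stabilizer T)) :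
    (∀ Φ : GStr.LM m M ≃ₘ⟮GStr.JL m, GStr.JL m⟯ GStr.LM m M, GStr.IsPrincipalAutomorphism Φ →
      (GStr.IsGeneralizedAutomorphism P Φ ↔
        GStr.LeavesInvariant Φ (GStr.inducedTensorField P))) ∧
    (∀ Ξ : (∀ u : GStr.LM m M, TangentSpace (GStr.JL m) u), GStr.IsInvariantVectorField Ξ →
      (GStr.IsInfinitesimalGeneralizedAutomorphism P Ξ ↔
        ∀ x : M, GStr.HasLieDerivAt Ξ (GStr.inducedTensorField P) x 0)) ∧
    (∀ Ξ : (∀ u : GStr.LM m M, TangentSpace (GStr.JL m) u), GStr.IsInvariantVectorField Ξ →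
      ∀ x : M, GStr.HasReductiveLieDerivAt P 𝔪 Ξ (GStr.inducedTensorField P) x 0) := by
  exact ⟨fun Φ hΦ => GStr.isGeneralizedAutomorphism_iff P Φ hΦ,
    fun Ξ hΞ => GStr.isInfinitesimalGeneralizedAutomorphism_iff P hΞ,
    fun Ξ hΞ x => GStr.hasReductiveLieDerivAt_zero P h𝔪 hΞ x⟩
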